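/- **Setting.** Let $\mathcal S,\mathcal A$ be measurable spaces (the $\sigma$-algebra of $\mathcal S$ countably generated), $\mathcal X=\mathcal S\times\mathcal A$. An MDP instance $M=(p,r)$ consists of a transition kernel $p(\cdot\mid s,a)$ on $\mathcal S$ and a law of the random reward $r'\in[0,1]$ given $(s,a)$, with mean $r(s,a)$. Fix a horizon $H\ge 1$, a target policy $\pi$ with initial distribution $\xi_0$, and a behavior policy $\overline\pi$ with initial distribution $\overline\xi_0$. Put $v^\pi=\mathbb E^\pi[\sum_{h=0}^H r(s_h,a_h)\mid s_0\sim\xi_0]$ and $V_h^\pi(s)=\mathbb E^\pi[\sum_{h'=h}^H r(s_{h'},a_{h'})\mid s_h=s]$. The dataset $\mathcal D$ consists of $K$ i.i.d. episodes $(s_{k,0},a_{k,0},r'_{k,0},\dots,s_{k,H},a_{k,H},r'_{k,H})$ generated by $\overline\pi$ from $\overline\xi_0$, and $N=KH$. Let $\mathcal Q$ be the linear span of measurable features $\phi=(\phi_1,\dots,\phi_d)^\top:\mathcal X\to\mathbb R^d$ such that $\Sigma=\mathbb E_M\big[\frac1H\sum_{h=0}^{H-1}\phi(s_{1,h},a_{1,h})\phi(s_{1,h},a_{1,h})^\top\big]$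 is positive definite and $\phi(s,a)^\top\Sigma^{-1}\phi(s,a)\le C_1d$ for all $(s,a)\in\mathcal X$. **Theorem (minimax lower bound).** Suppose that the MDP instance $M=(p,r)$ satisfies: * there are measurable sets $\overline{\mathcal S},\underline{\mathcal S}\subseteq\mathcal S$ such that for all $0\le h\le H$, $V_h^\pi(s)\ge\frac34(H-h+1)$ for $s\in\overline{\mathcal S}$ and $V_h^\pi(s)\le\frac14(H-h+1)$ for $s\in\underline{\mathcal S}$; * $m(\overline{\mathcal S})\ge c$ and $m(\underline{\mathcal S})\ge c$ for some $c>0$, where $m=\bigwedge_{s\in\mathcal S}m_s$ is an infimum in the lattice of measures on $\mathcal S$ and $m_s$ is the largest measure with $m_s\le p(\cdot\mid s,a)$ for $\overline\pi(\cdot\mid s)$-almost every $a$. (If $\overline\pi$ is deterministic, $m$ is the infimum of the measures $p(\cdot\mid s,\overline\pi(s))$; for finite $\mathcal S$, $m(B)=\sum_{s'\in B}\min_{s}p(s'\mid s,\overline\pi(s))$.) Then there is $N_0$ such that for all $N=KH\ge N_0$ and all $\varepsilon\ge\sqrt{\frac{C_1}{32}}\sqrt{\frac{cd}{N}}$, $$\inf_{\widehat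 v^\pi}\ \sup_{M'\in\mathcal N(M)}\ \mathbb P_{M'}\left(\big|v^\pi_{M'}-\widehat v^\pi(\mathcal D)\big|\ \ge\ \frac{\sqrt c}{24\sqrt N}\cdot\sup_{f\in\mathcal Q}\frac{\mathbb E^\pi_{M'}\big[\sum_{h=0}^{H-1}(H-h)f(s_h,a_h)\mid s_0\sim\xi_0\big]}{\sqrt{\mathbb E_{M'}\big[\frac1H\sum_{h=0}^{H-1}f^2(s_{1,h},a_{1,h})\big]}}\right)\ \ge\ \frac16 ,$$ where the infimum is over all estimators (real-valued measurable functions of $\mathcal D$), $v^\pi_{M'}$ is the value of $\pi$ in $M'$, and $\mathcal N(M)$ is the set of all instances $M'$ with the same reward law as $M$ whose transition kernel $p'$ satisfies $\sup_{(s,a)\in\mathcal X}\|p'(\cdot\mid s,a)-p(\cdot\mid s,a)\|_{\mathrm{TV}}\le\varepsilon$, with $\|\mu-\nu\|_{\mathrm{TV}}=\sup_B|\mu(B)-\nu(B)|$. In the supremum over $f$, a quotient $x/0$ is $+\infty$ for $x>0$ and is $0$ for $x=0$. -/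

import Mathlib

open MeasureTheory ProbabilityTheory
open scoped ENNReal

noncomputable section

/-- A Markov decision process with transition kernel `p(ds' | s, a)` and with the conditional law
of the random reward `r' ∈ [0, 1]` given `(s, a)`. -/
structure MDP (S A : Type*) [MeasurableSpace S] [MeasurableSpace A] where
  /-- the transition kernel -/
  trans : Kernel (S × A) S
  /-- the conditional law of the random reward -/
  rew : Kernel (S × A) ℝ
  markov_trans : IsMarkovKernel trans
  markov_rew : IsMarkovKernel rew
  rew_mem : ∀ x, ∀ᵐ y ∂(rew x), y ∈ Set.Icc (0 : ℝ) 1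

attribute [instance] MDP.markov_trans MDP.markov_rew

namespace MDP

variable {S A : Type*} [MeasurableSpace S] [MeasurableSpace A]

/-- The mean reward `r(s, a) = E[r' | s, a]`. -/
def meanReward (M : MDP S A) (x : S × A) : ℝ := ∫ y, y ∂(M.rew x)

/-- One step taken from the state `s`: the law of `((s, a), r')` with `a ∼ π(· | s)` and `r'` drawn
from the reward law at `(s, a)`. -/
def emit (M : MDP S A) (π : Kernel S A) : Kernel S ((S × A) × ℝ) :=
  (Kernel.id ×ₖ π) ⊗ₖ Kernel.prodMkLeft S M.rew

instance (M : MDP S A) (π : Kernel S A) [IsMarkovKernel π] : IsMarkovKernel (M.emit π) := by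
  unfold emit; infer_instance

/-- The law of `((s₀, a₀), r₀'), …, ((sₙ, aₙ), rₙ')` under the policy `π`, started from `s₀ = s`. -/
def episodeFrom (M : MDP S A) (π : Kernel S A) :
    (n : ℕ) → Kernel S (Fin (n + 1) → (S × A) × ℝ)
  | 0 => (M.emit π).map fun z _ => z
  | n + 1 =>
    (M.emit π ⊗ₖ Kernel.prodMkLeft S
      ((episodeFrom M π n ∘ₖ M.trans).comap Prod.fst measurable_fst)).map
        fun z => (Fin.cons z.1 z.2 : Fin (n + 2) → (S × A) × ℝ)

theorem measurable_finCons {Z : Type*} [MeasurableSpace Z] (n : ℕ) :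
    Measurable fun z : Z × (Fin n → Z) => (Fin.cons z.1 z.2 : Fin (n + 1) → Z) := by
  refine measurable_pi_lambda _ fun i => ?_
  refine Fin.cases ?_ (fun j => ?_) i
  · simp only [Fin.cons_zero]; fun_prop
  · simp only [Fin.cons_succ]; fun_prop

instance (M : MDP S A) (π : Kernel S A) [IsMarkovKernel π] (n : ℕ) :
    IsMarkovKernel (M.episodeFrom π n) := by
  induction n with
  | zero => exact Kernel.IsMarkovKernel.map _ (by fun_prop)
  | succ n ih => exact Kernel.IsMarkovKernel.map _ (measurable_finCons _)

/-- The law of an episode `((s₀, a₀), r₀'), …, ((s_H, a_H), r_H')` with `s₀ ∼ ξ`. -/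
def episode (M : MDP S A) (π : Kernel S A) (ξ : Measure S) (H : ℕ) :
    Measure (Fin (H + 1) → (S × A) × ℝ) :=
  (M.episodeFrom π H) ∘ₘ ξ

/-- The law of the dataset: `K` i.i.d. episodes of the behavior policy `πb` with initial
distribution `ξb`. -/
def dataLaw (M : MDP S A) (πb : Kernel S A) (ξb : Measure S) (H K : ℕ) :
    Measure (Fin K → Fin (H + 1) → (S × A) × ℝ) :=
  Measure.pi fun _ => M.episode πb ξb H

/-- `v^π = E^π[∑_{h=0}^H r(s_h, a_h) | s₀ ∼ ξ₀]`. -/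
def value (M : MDP S A) (π : Kernel S A) (ξ₀ : Measure S) (H : ℕ) : ℝ :=
  ∫ τ, ∑ h, M.meanReward (τ h).1 ∂(M.episode π ξ₀ H)

/-- `V_h^π(s) = E^π[∑_{h'=h}^H r(s_{h'}, a_{h'}) | s_h = s]` for `h ≤ H`; the chain is homogeneous,
so this is the expected reward of `H - h + 1` steps started from `s`. -/
def stateValue (M : MDP S A) (π : Kernel S A) (H h : ℕ) (s : S) : ℝ :=
  ∫ τ, ∑ i, M.meanReward (τ i).1 ∂(M.episodeFrom π (H - h) s)

/-- The largest measure that lies below `p(· | s, a)` for every state `s` and `πb(· | s)`-almost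
every action `a`. For a deterministic behavior policy it is the infimum of the measures
`p(· | s, πb(s))`, which has the density `s' ↦ min_s p(s' | s, πb(s))` when the transition laws have
densities and there are countably many states. -/
def minTrans (M : MDP S A) (πb : Kernel S A) : Measure S :=
  ⨅ s, essInf (fun a => M.trans (s, a)) (πb s)

/-- `E[(1/H) ∑_{h=0}^{H-1} f(s_{1,h}, a_{1,h})]`, for an episode of the behavior policy. -/
def dataMean (M : MDP S A) (πb : Kernel S A) (ξb : Measure S) (H : ℕ) (f : S × A → ℝ) : ℝ :=
  ∫ τ, (1 / (H : ℝ)) * ∑ h : Fin H, f (τ h.castSucc).1 ∂(M.episode πb ξb H)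

/-- The uncentered covariance matrix
`Σ = E[(1/H) ∑_{h=0}^{H-1} φ(s_{1,h}, a_{1,h}) φ(s_{1,h}, a_{1,h})ᵀ]` of the data. -/
def dataCov (M : MDP S A) (πb : Kernel S A) (ξb : Measure S) (H : ℕ) {d : ℕ}
    (φ : S × A → Fin d → ℝ) : Matrix (Fin d) (Fin d) ℝ :=
  Matrix.of fun i j => M.dataMean πb ξb H fun x => φ x i * φ x j

/-- `E^π[∑_{h=0}^{H-1} (H - h) f(s_h, a_h) | s₀ ∼ ξ₀]`. -/
def weightedMean (M : MDP S A) (π : Kernel S A) (ξ₀ : Measure S) (H : ℕ) (f : S × A → ℝ) : ℝ :=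
  ∫ τ, ∑ h : Fin H, ((H : ℝ) - (h : ℕ)) * f (τ h.castSucc).1 ∂(M.episode π ξ₀ H)

/-- The distributional mismatch
`sup_{f ∈ 𝒬} E^π[∑_{h<H} (H - h) f(s_h, a_h)] / √(E[(1/H) ∑_{h<H} f²(s_{1,h}, a_{1,h})])`,
as an extended nonnegative number (with `x / 0 = ∞` for `x > 0` and `0 / 0 = 0`). The linear space
`𝒬` contains `0`, so that replacing negative numerators by `0` does not change the supremum. -/
def mismatch (M : MDP S A) (π πb : Kernel S A) (ξ₀ ξb : Measure S) (H : ℕ)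
    (𝒬 : Submodule ℝ (S × A → ℝ)) : ℝ≥0∞ :=
  ⨆ f ∈ 𝒬, ENNReal.ofReal (M.weightedMean π ξ₀ H f) /
    ENNReal.ofReal (Real.sqrt (M.dataMean πb ξb H fun x => f x ^ 2))

/-- Total variation distance `sup_B |μ(B) - ν(B)|` of two probability measures. -/
def tvDist (μ ν : Measure S) : ℝ :=
  ⨆ B : {B : Set S // MeasurableSet B}, |μ.real B - ν.real B|

/-- The instances `M' = (p', r)` with `sup_{s,a} ‖p'(· | s, a) - p(· | s, a)‖_TV ≤ ε` and with the
same rewards as `M`. -/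
def neighborhood (M : MDP S A) (ε : ℝ) : Set (MDP S A) :=
  {M' | M'.rew = M.rew ∧ ∀ x, tvDist (M'.trans x) (M.trans x) ≤ ε}

end MDP

/-- The function class spanned by the features `φ₁, …, φ_d`. -/
def featureSpan {X : Type*} {d : ℕ} (φ : X → Fin d → ℝ) : Submodule ℝ (X → ℝ) :=
  Submodule.span ℝ (Set.range fun i x => φ x i)

end

/-! This is Le Cam's two-point method. Take `f` in the span with empirical second moment 1 that
nearly attains the mismatch `R` of `M`, and put `δ = (t f)⁺` with `t = √(c / (32 N))`. Condition the
common minorant `minTrans` on the high-value and on the low-value set to get `ν₁`, `ν₂`. The rivals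
are the tilts of `M` with kernels `(1 - δ) p + δ νᵢ`.

They are statistically close: `νᵢ ≤ c⁻¹ p` along the behavior policy, so the chi-square divergence
of one episode from `M` is at most about `c⁻¹ t² H = 1 / (32 K)`, and `K` episodes cost a bounded
factor (`lintegral_mixture_sq_le`, `lintegral_episodeFrom_tilt_sq_le`, `lintegral_pi_sq_le`). Both
rivals are compared with `M`, and `le_measure_or_le_measure_of_sq_le` turns this into an error
probability.

They have different values: each diversion of mass `δ` with `m` steps left is worth about `(3/4 -
1/4) m δ`, so the gap is about half the weighted mean of `δ`, that is, at least about `t R / 2`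
(`lvalue_tilt_add_le`, `value_tilt_add_le`).

The claim measures errors by the mismatch of the rival itself. Since `δ ≤ η = t √(C₁ d) → 0`, rival
episode laws dominate `(1 - η)^H` times those of `M`, which keeps the mismatch below `1.01 R`
(`mismatch_le`) and state values near those of `M`. The slack between `√(1/32) / 2` and `2 / 24`
absorbs all such losses for large `N`. -/

/-! ### Cauchy–Schwarz and essential infima of measures. -/

/-- The Cauchy–Schwarz inequality for lower integrals, for a function whose square is bounded by
a product. -/
theorem lintegral_sq_le_mul_of_sq_le {α : Type*} [MeasurableSpace α] {μ : Measure α}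
    {g w q : α → ℝ≥0∞} (hw : AEMeasurable w μ) (hq : AEMeasurable q μ)
    (h : ∀ᵐ x ∂μ, g x ^ 2 ≤ w x * q x) :
    (∫⁻ x, g x ∂μ) ^ 2 ≤ (∫⁻ x, w x ∂μ) * ∫⁻ x, q x ∂μ := by
  have hroot : ∀ x : ℝ≥0∞, (x ^ (1 / 2 : ℝ)) ^ 2 = x := fun x => by
    rw [← ENNReal.rpow_natCast, ← ENNReal.rpow_mul]; norm_num
  have h1 : ∫⁻ x, g x ∂μ ≤ ∫⁻ x, w x ^ (1 / 2 : ℝ) * q x ^ (1 / 2 : ℝ) ∂μ := by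
    refine lintegral_mono_ae ?_
    filter_upwards [h] with x hx
    rw [← ENNReal.mul_rpow_of_nonneg _ _ (by norm_num)]
    have h2 := ENNReal.rpow_le_rpow hx (show (0 : ℝ) ≤ 1 / 2 by norm_num)
    rwa [← ENNReal.rpow_natCast, ← ENNReal.rpow_mul,
      show ((2 : ℕ) : ℝ) * (1 / 2) = 1 by norm_num, ENNReal.rpow_one] at h2
  calc (∫⁻ x, g x ∂μ) ^ 2
      ≤ ((∫⁻ x, w x ∂μ) ^ (1 / 2 : ℝ) * (∫⁻ x, q x ∂μ) ^ (1 / 2 : ℝ)) ^ 2 := by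
        gcongr
        exact h1.trans (ENNReal.lintegral_mul_norm_pow_le hw hq (by norm_num) (by norm_num)
          (by norm_num))
    _ = _ := by rw [mul_pow, hroot, hroot]

/-- The set of measures that lie below `κ a` for almost every `a` has a greatest element. -/
theorem ae_essInf_measure_le {A S : Type*} [MeasurableSpace A] [MeasurableSpace S]
    (μ : Measure A) [NeZero μ] (κ : A → Measure S) [∀ a, IsFiniteMeasure (κ a)] :
    ∀ᵐ a ∂μ, essInf κ μ ≤ κ a := by
  set X : Set (Measure S) := {x | ∀ᵐ a ∂μ, x ≤ κ a} with hX
  have hess : essInf κ μ = sSup X := by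
    rw [essInf, Filter.liminf_eq]
  have hfin : ∀ x ∈ X, x Set.univ < ∞ := by
    intro x hx
    obtain ⟨a, ha⟩ := (show ∀ᵐ a ∂μ, x ≤ κ a from hx).exists
    exact (ha Set.univ).trans_lt (measure_lt_top _ _)
  -- An uncountable supremum could accumulate exceptional null sets. A sequence in `X` that
  -- maximizes the total mass involves only countably many, and finiteness of mass forces its
  -- supremum to dominate all of `X`.
  obtain ⟨u, -, hu, huX⟩ := exists_seq_tendsto_sSup
    (S := (fun x : Measure S => x Set.univ) '' X) ⟨_, 0,
      (Filter.Eventually.of_forall fun a => Measure.zero_le (κ a) : ∀ᵐ a ∂μ, 0 ≤ κ a), rfl⟩ (OrderTop.bddAbove _)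
  choose x hxX hxu using huX
  have hz : (⨆ n, x n) ∈ X := by
    have : ∀ᵐ a ∂μ, ∀ n, x n ≤ κ a := ae_all_iff.2 hxX
    filter_upwards [this] with a ha
    exact iSup_le ha
  have hmax : ∀ y ∈ X, y Set.univ ≤ (⨆ n, x n) Set.univ := by
    intro y hy
    refine (le_sSup (Set.mem_image_of_mem (fun x : Measure S => x Set.univ) hy)).trans ?_
    refine le_of_tendsto' hu fun n => ?_
    rw [← hxu n]
    exact le_iSup x n Set.univ
  have hle : sSup X ≤ ⨆ n, x n := by
    refine sSup_le fun y hy => ?_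
    have hsup : (⨆ n, x n) ⊔ y ∈ X := by
      filter_upwards [show ∀ᵐ a ∂μ, _ from hz, show ∀ᵐ a ∂μ, _ from hy] with a h1 h2
      exact sup_le h1 h2
    have := (⟨hfin _ hsup⟩ : IsFiniteMeasure ((⨆ n, x n) ⊔ y))
    have := (⟨hfin _ hz⟩ : IsFiniteMeasure (⨆ n, x n))
    have heq : (⨆ n, x n) = (⨆ n, x n) ⊔ y :=
      Measure.eq_of_le_of_measure_univ_eq le_sup_left
        (le_antisymm (le_sup_left (a := ⨆ n, x n) (b := y) Set.univ) (hmax _ hsup))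
    rw [heq]
    exact le_sup_right
  rw [hess]
  filter_upwards [show ∀ᵐ a ∂μ, _ from hz] with a ha
  exact hle.trans ha

/-! ### One-step recursion for the laws of episodes. -/

namespace MDP

variable {S A : Type*} [MeasurableSpace S] [MeasurableSpace A]

theorem ae_minTrans_le (M : MDP S A) (πb : Kernel S A) [IsMarkovKernel πb] (s : S) :
    ∀ᵐ a ∂(πb s), M.minTrans πb ≤ M.trans (s, a) := by
  filter_upwards [ae_essInf_measure_le (πb s) fun a => M.trans (s, a)] with a ha
  exact (iInf_le _ s).trans ha

/-- The law of `(a, r')` given the state `s`, with `a ∼ π(· | s)` and `r'` drawn from the reward law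
at `(s, a)`. -/
noncomputable def actLaw (M : MDP S A) (π : Kernel S A) (s : S) : Measure (A × ℝ) :=
  π s ⊗ₘ M.rew.sectR s

instance (M : MDP S A) (π : Kernel S A) [IsMarkovKernel π] (s : S) :
    IsProbabilityMeasure (M.actLaw π s) := by
  unfold actLaw; infer_instance

theorem ae_actLaw (M : MDP S A) (π : Kernel S A) [IsMarkovKernel π] (s : S) {P : A → Prop}
    (h : ∀ᵐ a ∂(π s), P a) : ∀ᵐ q ∂(M.actLaw π s), P q.1 := by
  rw [← Measure.fst_compProd (π s) (M.rew.sectR s)] at h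
  exact ae_of_ae_map measurable_fst.aemeasurable h

theorem lintegral_emit (M : MDP S A) (π : Kernel S A) [IsMarkovKernel π] (s : S)
    {F : (S × A) × ℝ → ℝ≥0∞} (hF : Measurable F) :
    ∫⁻ z, F z ∂(M.emit π s) = ∫⁻ q, F ((s, q.1), q.2) ∂(M.actLaw π s) := by
  have h1 : Measurable fun b : S × A => ∫⁻ y, F (b, y) ∂(M.rew b) :=
    Measurable.lintegral_kernel_prod_right (by fun_prop)
  rw [emit, Kernel.lintegral_compProd _ _ _ hF, Kernel.id]
  simp only [Kernel.lintegral_prodMkLeft]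
  rw [Kernel.lintegral_deterministic_prod _ _ _ h1, actLaw, Measure.lintegral_compProd (by fun_prop)]
  rfl

theorem lintegral_episodeFrom_zero (M : MDP S A) (π : Kernel S A) [IsMarkovKernel π] (s : S)
    {F : (Fin 1 → (S × A) × ℝ) → ℝ≥0∞} (hF : Measurable F) :
    ∫⁻ τ, F τ ∂(M.episodeFrom π 0 s) = ∫⁻ q, F (fun _ => ((s, q.1), q.2)) ∂(M.actLaw π s) := by
  rw [episodeFrom, Kernel.lintegral_map _ (by fun_prop) _ hF, lintegral_emit]
  fun_prop

theorem lintegral_episodeFrom_succ (M : MDP S A) (π : Kernel S A) [IsMarkovKernel π] (n : ℕ) (s : S)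
    {F : (Fin (n + 2) → (S × A) × ℝ) → ℝ≥0∞} (hF : Measurable F) :
    ∫⁻ τ, F τ ∂(M.episodeFrom π (n + 1) s) =
      ∫⁻ q, ∫⁻ s', ∫⁻ τ, F (Fin.cons ((s, q.1), q.2) τ : Fin (n + 2) → (S × A) × ℝ)
        ∂(M.episodeFrom π n s') ∂(M.trans (s, q.1)) ∂(M.actLaw π s) := by
  have hc : Measurable fun z : ((S × A) × ℝ) × (Fin (n + 1) → (S × A) × ℝ) =>
      F (Fin.cons z.1 z.2 : Fin (n + 2) → (S × A) × ℝ) := hF.comp (measurable_finCons _)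
  have h1 : Measurable fun z : (S × A) × ℝ => ∫⁻ s', ∫⁻ τ,
      F (Fin.cons z τ : Fin (n + 2) → (S × A) × ℝ) ∂(M.episodeFrom π n s') ∂(M.trans z.1) := by
    refine Measurable.lintegral_kernel_prod_right (κ := M.trans.comap Prod.fst measurable_fst) ?_
    refine Measurable.lintegral_kernel_prod_right
      (κ := (M.episodeFrom π n).comap (fun z : ((S × A) × ℝ) × S => z.2) measurable_snd) ?_
    exact hc.comp (by fun_prop : Measurable fun w : (((S × A) × ℝ) × S) ×
      (Fin (n + 1) → (S × A) × ℝ) => (w.1.1, w.2))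
  rw [← M.lintegral_emit π s h1, episodeFrom, Kernel.lintegral_map _ (measurable_finCons _) _ hF,
    Kernel.lintegral_compProd _ _ _ hc]
  refine lintegral_congr fun z => ?_
  rw [Kernel.lintegral_prodMkLeft, Kernel.comap_apply, Kernel.lintegral_comp]
  exact hc.comp (by fun_prop : Measurable fun τ => (z, τ))

/-- The expectation of a functional that splits into a function of the first step and a functional
of the remaining episode. -/
theorem lintegral_episodeFrom_succ_add (M : MDP S A) (π : Kernel S A) [IsMarkovKernel π] (n : ℕ)
    (s : S) {f : S × A → ℝ≥0∞} (hf : Measurable f)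
    {G : (Fin (n + 1) → (S × A) × ℝ) → ℝ≥0∞} (hG : Measurable G)
    {F : (Fin (n + 2) → (S × A) × ℝ) → ℝ≥0∞}
    (hF : ∀ z τ, F (Fin.cons z τ : Fin (n + 2) → (S × A) × ℝ) = f z.1 + G τ) :
    ∫⁻ τ, F τ ∂(M.episodeFrom π (n + 1) s) =
      ∫⁻ q, (f (s, q.1) + ∫⁻ s', ∫⁻ τ, G τ ∂(M.episodeFrom π n s') ∂(M.trans (s, q.1)))
        ∂(M.actLaw π s) := by
  have hF' : F = fun τ => f (τ 0).1 + G (Fin.tail τ) := by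
    funext τ; rw [← hF, Fin.cons_self_tail]
  have hFm : Measurable F := by
    rw [hF']; unfold Fin.tail; fun_prop
  rw [M.lintegral_episodeFrom_succ π n s hFm]
  refine lintegral_congr fun q => ?_
  simp only [hF]
  simp_rw [lintegral_add_left measurable_const]
  simp

end MDP

/-! ### Chi-square bounds for mixtures and for products. -/

/-- A chi-square bound for the mixture `(1 - δ) p + δ ν`, when `ν` has a density at most `k` with
respect to `p`. -/
theorem lintegral_mixture_sq_le {S : Type*} [MeasurableSpace S] {p ν : Measure S}
    [IsProbabilityMeasure p] [IsProbabilityMeasure ν] {k : NNReal} (hν : ν ≤ k • p)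
    {δ θ : ℝ≥0∞} (hδ : δ ≤ 1) (hθ : (1 + δ * k) ^ 2 ≤ θ) {g D q : S → ℝ≥0∞}
    (hg : Measurable g) (hD : Measurable D) (hq : Measurable q)
    (h : ∀ x, g x ^ 2 ≤ (1 + D x) * q x) :
    (∫⁻ x, g x ∂((1 - δ) • p + δ • ν)) ^ 2 ≤
      (1 + (k * δ ^ 2 + θ * ∫⁻ x, D x ∂p)) * ∫⁻ x, q x ∂p := by
  set ρ : S → ℝ≥0∞ := ν.rnDeriv p
  have hρm : Measurable ρ := Measure.measurable_rnDeriv _ _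
  have hac : ν ≪ p := (Measure.absolutelyContinuous_of_le hν).trans
    (Measure.smul_absolutelyContinuous (c := k))
  have hwd : p.withDensity ρ = ν := Measure.withDensity_rnDeriv_eq _ _ hac
  have hρk : ∀ᵐ x ∂p, ρ x ≤ k := by
    refine ae_le_of_forall_setLIntegral_le_of_sigmaFinite hρm fun B hB _ => ?_
    rw [← withDensity_apply _ hB, hwd, setLIntegral_const]
    exact hν B
  have hρ1 : ∫⁻ x, ρ x ∂p = 1 := by
    rw [← setLIntegral_univ, ← withDensity_apply _ MeasurableSet.univ, hwd, measure_univ]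
  set L : S → ℝ≥0∞ := fun x => (1 - δ) + δ * ρ x
  have hLm : Measurable L := by fun_prop
  have hδtop : δ ≠ ∞ := ne_top_of_le_ne_top ENNReal.one_ne_top hδ
  have hmix : ∀ F : S → ℝ≥0∞, Measurable F →
      ∫⁻ x, F x ∂((1 - δ) • p + δ • ν) = ∫⁻ x, L x * F x ∂p := by
    intro F hF
    rw [lintegral_add_measure, lintegral_smul_measure, lintegral_smul_measure, ← hwd,
      lintegral_withDensity_eq_lintegral_mul _ hρm hF]
    simp only [L, add_mul, smul_eq_mul, Pi.mul_apply, mul_assoc]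
    rw [lintegral_add_left (by fun_prop), lintegral_const_mul _ (by fun_prop),
      lintegral_const_mul _ (by fun_prop)]
  have hLθ : ∀ᵐ x ∂p, L x ^ 2 ≤ θ := by
    filter_upwards [hρk] with x hx
    refine le_trans ?_ hθ
    have : L x ≤ 1 + δ * k := by
      simp only [L]; gcongr; exact tsub_le_self
    gcongr
  -- The first-order term in `δ` cancels because `∫ ρ = 1`, and `∫ ρ² ≤ k ∫ ρ = k`.
  have hL2 : ∫⁻ x, L x ^ 2 ∂p ≤ 1 + k * δ ^ 2 := by
    have h1 : ∀ᵐ x ∂p, L x ^ 2 ≤ ((1 - δ) ^ 2) + (2 * (1 - δ) * δ + k * δ ^ 2) * ρ x := by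
      filter_upwards [hρk] with x hx
      calc L x ^ 2 = (1 - δ) ^ 2 + (2 * (1 - δ) * δ * ρ x + ρ x * δ ^ 2 * ρ x) := by
            simp only [L]; ring
        _ ≤ (1 - δ) ^ 2 + (2 * (1 - δ) * δ * ρ x + k * δ ^ 2 * ρ x) := by gcongr
        _ = _ := by ring
    refine (lintegral_mono_ae h1).trans ?_
    rw [lintegral_add_left (by fun_prop), lintegral_const_mul _ hρm, hρ1, lintegral_const,
      measure_univ]
    have h2 : (1 - δ) + δ = 1 := tsub_add_cancel_of_le hδ
    calc (1 - δ) ^ 2 * 1 + (2 * (1 - δ) * δ + k * δ ^ 2) * 1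
        ≤ ((1 - δ) + δ) ^ 2 + k * δ ^ 2 := by
          have : ((1 - δ) + δ) ^ 2 + k * δ ^ 2
            = ((1 - δ) ^ 2 * 1 + (2 * (1 - δ) * δ + k * δ ^ 2) * 1) + δ ^ 2 := by ring
          rw [this]; exact le_self_add
      _ = 1 + k * δ ^ 2 := by rw [h2, one_pow]
  rw [hmix g hg]
  -- `D` is the excess already accumulated by the later steps. Only it is charged the crude factor
  -- `θ ≥ L²`; the term 1 keeps the bound `1 + k δ²`, so that the total excess stays quadratic in
  -- `δ`.
  refine (lintegral_sq_le_mul_of_sq_le (w := fun x => L x ^ 2 * (1 + D x)) (q := q)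
    (by fun_prop) hq.aemeasurable (Filter.Eventually.of_forall fun x => ?_)).trans ?_
  · rw [mul_pow, mul_assoc]; gcongr; exact h x
  · gcongr
    calc ∫⁻ x, L x ^ 2 * (1 + D x) ∂p
        ≤ ∫⁻ x, (L x ^ 2 + θ * D x) ∂p := by
          refine lintegral_mono_ae ?_
          filter_upwards [hLθ] with x hx
          rw [mul_add, mul_one]; gcongr
      _ = ∫⁻ x, L x ^ 2 ∂p + θ * ∫⁻ x, D x ∂p := by
          rw [lintegral_add_left (by fun_prop), lintegral_const_mul _ hD]
      _ ≤ _ := by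
          rw [← add_assoc]; gcongr

/-- The inequality `(∫ F dμ)² ≤ C ∫ F² dν` tensorizes. -/
theorem lintegral_pi_sq_le {Z : Type*} [MeasurableSpace Z] {μ ν : Measure Z}
    [IsProbabilityMeasure μ] [IsProbabilityMeasure ν] {C : ℝ≥0∞}
    (h : ∀ F : Z → ℝ≥0∞, Measurable F → (∫⁻ z, F z ∂μ) ^ 2 ≤ C * ∫⁻ z, F z ^ 2 ∂ν) (K : ℕ)
    {F : (Fin K → Z) → ℝ≥0∞} (hF : Measurable F) :
    (∫⁻ D, F D ∂(Measure.pi fun _ => μ)) ^ 2 ≤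
      C ^ K * ∫⁻ D, F D ^ 2 ∂(Measure.pi fun _ => ν) := by
  induction K with
  | zero =>
    rw [Measure.pi_of_empty _ (fun i : Fin 0 => i.elim0), Measure.pi_of_empty _ (fun i : Fin 0 => i.elim0),
      lintegral_dirac' _ hF, lintegral_dirac' _ (by fun_prop)]
    simp
  | succ K ih =>
    have hsplit : ∀ (ρ : Measure Z) [IsProbabilityMeasure ρ] (G : (Fin (K + 1) → Z) → ℝ≥0∞),
        Measurable G → ∫⁻ D, G D ∂(Measure.pi fun _ => ρ) =
          ∫⁻ z, ∫⁻ D, G (Fin.cons z D : Fin (K + 1) → Z) ∂(Measure.pi fun _ => ρ) ∂ρ := by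
      intro ρ _ G hG
      have hmp := (measurePreserving_piFinSuccAbove (fun _ : Fin (K + 1) => ρ) 0).symm
      rw [← hmp.lintegral_comp hG]
      rw [lintegral_prod _ (by
        exact (hG.comp (MeasurableEquiv.measurable _)).aemeasurable)]
      refine lintegral_congr fun z => lintegral_congr fun D => ?_
      change G (Fin.insertNth 0 z D) = _
      rw [Fin.insertNth_zero']
    have hc : Measurable fun w : Z × (Fin K → Z) => F (Fin.cons w.1 w.2 : Fin (K + 1) → Z) :=
      hF.comp (MDP.measurable_finCons _)
    rw [hsplit μ F hF, hsplit ν _ (by fun_prop)]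
    calc _ ≤ C * ∫⁻ z, (∫⁻ D, F (Fin.cons z D : Fin (K + 1) → Z) ∂(Measure.pi fun _ => μ)) ^ 2 ∂ν :=
          h _ (Measurable.lintegral_prod_right' hc)
      _ ≤ C * ∫⁻ z, (C ^ K * ∫⁻ D, F (Fin.cons z D : Fin (K + 1) → Z) ^ 2
            ∂(Measure.pi fun _ => ν)) ∂ν := by
          gcongr with z
          exact ih (hc.comp (by fun_prop : Measurable fun D => (z, D)))
      _ = _ := by
          rw [lintegral_const_mul _ (Measurable.lintegral_prod_right' (hc.pow_const 2)), pow_succ]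
          ring

/-! ### Tilted instances and domination of their episode laws. -/

namespace MDP

variable {S A : Type*} [MeasurableSpace S] [MeasurableSpace A]

/-- The instance whose transition law at `x` is the mixture `(1 - δ x) p(· | x) + δ x ν`. -/
noncomputable def tilt (M : MDP S A) (ν : Measure S) [IsProbabilityMeasure ν] (δ : S × A → ℝ≥0∞)
    (hδ : Measurable δ) (hδ1 : ∀ x, δ x ≤ 1) : MDP S A where
  trans :=
    { toFun := fun x => (1 - δ x) • M.trans x + δ x • ν
      measurable' := by
        refine Measure.measurable_of_measurable_coe _ fun B hB => ?_
        have := Kernel.measurable_coe M.trans hB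
        simp only [Measure.coe_add, Measure.coe_smul, Pi.add_apply, Pi.smul_apply, smul_eq_mul]
        fun_prop }
  rew := M.rew
  markov_trans := ⟨fun x => ⟨by
    change ((1 - δ x) • M.trans x + δ x • ν) Set.univ = 1
    simp [tsub_add_cancel_of_le (hδ1 x)]⟩⟩
  markov_rew := M.markov_rew
  rew_mem := M.rew_mem

section tilt

variable (M : MDP S A) (ν : Measure S) [IsProbabilityMeasure ν] {δ : S × A → ℝ≥0∞}
  (hδ : Measurable δ) (hδ1 : ∀ x, δ x ≤ 1)

theorem tilt_trans (x : S × A) :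
    (M.tilt ν δ hδ hδ1).trans x = (1 - δ x) • M.trans x + δ x • ν := rfl

theorem lintegral_tilt_trans (x : S × A) (F : S → ℝ≥0∞) :
    ∫⁻ s, F s ∂((M.tilt ν δ hδ hδ1).trans x) =
      (1 - δ x) * ∫⁻ s, F s ∂(M.trans x) + δ x * ∫⁻ s, F s ∂ν := by
  rw [tilt_trans, lintegral_add_measure, lintegral_smul_measure, lintegral_smul_measure]
  rfl

theorem tvDist_tilt_le {r : ℝ} (hr : 0 ≤ r) (x : S × A) (hx : δ x ≤ ENNReal.ofReal r) :
    tvDist ((M.tilt ν δ hδ hδ1).trans x) (M.trans x) ≤ r := by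
  refine Real.iSup_le (fun B => ?_) hr
  have h1 : (M.tilt ν δ hδ hδ1).trans x B.1 = (1 - δ x) * M.trans x B.1 + δ x * ν B.1 := rfl
  have htop : δ x ≠ ∞ := ne_top_of_le_ne_top ENNReal.one_ne_top (hδ1 x)
  have hxr : (δ x).toReal ≤ r := ENNReal.toReal_le_of_le_ofReal hr hx
  have h2 : ((M.tilt ν δ hδ hδ1).trans x).real B.1 =
      (1 - (δ x).toReal) * (M.trans x).real B.1 + (δ x).toReal * ν.real B.1 := by
    rw [Measure.real, h1, ENNReal.toReal_add (by finiteness) (by finiteness), ENNReal.toReal_mul,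
      ENNReal.toReal_mul, ENNReal.toReal_sub_of_le (hδ1 x) ENNReal.one_ne_top]
    rfl
  rw [h2, show (1 - (δ x).toReal) * (M.trans x).real B.1 + (δ x).toReal * ν.real B.1 -
    (M.trans x).real B.1 = (δ x).toReal * (ν.real B.1 - (M.trans x).real B.1) by ring, abs_mul,
    abs_of_nonneg ENNReal.toReal_nonneg]
  have h3 : |ν.real B.1 - (M.trans x).real B.1| ≤ 1 := by
    have := measureReal_le_one (μ := ν) (s := B.1)
    have := measureReal_le_one (μ := M.trans x) (s := B.1)
    have := measureReal_nonneg (μ := ν) (s := B.1)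
    have := measureReal_nonneg (μ := M.trans x) (s := B.1)
    rw [abs_le]; constructor <;> linarith
  calc _ ≤ (δ x).toReal * 1 := by gcongr
    _ ≤ r := by simpa using hxr

theorem tilt_mem_neighborhood {r ε : ℝ} (hr : 0 ≤ r) (hx : ∀ x, δ x ≤ ENNReal.ofReal r)
    (hε : r ≤ ε) : M.tilt ν δ hδ hδ1 ∈ M.neighborhood ε :=
  ⟨rfl, fun x => (M.tvDist_tilt_le ν hδ hδ1 hr x (hx x)).trans hε⟩

end tilt

/-- If the transition laws of `M'` dominate `q` times those of `M`, then so do the laws of the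
episodes, up to a power of `q`. -/
theorem pow_mul_lintegral_episodeFrom_le {M M' : MDP S A} (hrew : M'.rew = M.rew) {q : ℝ≥0∞}
    (h : ∀ x, q • M.trans x ≤ M'.trans x) (π : Kernel S A) [IsMarkovKernel π] (n : ℕ) (s : S)
    {F : (Fin (n + 1) → (S × A) × ℝ) → ℝ≥0∞} (hF : Measurable F) :
    q ^ n * ∫⁻ τ, F τ ∂(M.episodeFrom π n s) ≤ ∫⁻ τ, F τ ∂(M'.episodeFrom π n s) := by
  have hact : M'.actLaw π = M.actLaw π := by unfold actLaw; rw [hrew]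
  induction n generalizing s with
  | zero =>
    rw [lintegral_episodeFrom_zero _ _ _ hF, lintegral_episodeFrom_zero _ _ _ hF, hact]
    simp
  | succ n ih =>
    rw [lintegral_episodeFrom_succ _ _ _ _ hF, lintegral_episodeFrom_succ _ _ _ _ hF, hact]
    refine (lintegral_const_mul_le _ _).trans (lintegral_mono fun z => ?_)
    have hc : Measurable fun τ => F (Fin.cons ((s, z.1), z.2) τ : Fin (n + 2) → (S × A) × ℝ) :=
      hF.comp ((measurable_finCons _).comp (by fun_prop : Measurable fun τ => (((s, z.1), z.2), τ)))
    calc _ = q * (q ^ n * ∫⁻ s', ∫⁻ τ, F (Fin.cons ((s, z.1), z.2) τ :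
            Fin (n + 2) → (S × A) × ℝ) ∂(M.episodeFrom π n s') ∂(M.trans (s, z.1))) := by ring
      _ ≤ q * ∫⁻ s', ∫⁻ τ, F (Fin.cons ((s, z.1), z.2) τ :
            Fin (n + 2) → (S × A) × ℝ) ∂(M'.episodeFrom π n s') ∂(M.trans (s, z.1)) := by
          gcongr
          exact (lintegral_const_mul_le _ _).trans (lintegral_mono fun s' => ih s' hc)
      _ = ∫⁻ s', ∫⁻ τ, F (Fin.cons ((s, z.1), z.2) τ :
            Fin (n + 2) → (S × A) × ℝ) ∂(M'.episodeFrom π n s') ∂(q • M.trans (s, z.1)) := by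
          rw [lintegral_smul_measure]; rfl
      _ ≤ _ := lintegral_mono' (h _) le_rfl

theorem smul_episode_le {M M' : MDP S A} (hrew : M'.rew = M.rew) {q : ℝ≥0∞}
    (h : ∀ x, q • M.trans x ≤ M'.trans x) (π : Kernel S A) [IsMarkovKernel π] (ξ : Measure S)
    (n : ℕ) : q ^ n • M.episode π ξ n ≤ M'.episode π ξ n := by
  refine Measure.le_iff.2 fun B hB => ?_
  rw [Measure.smul_apply, episode, episode, Measure.bind_apply hB (Kernel.aemeasurable _),
    Measure.bind_apply hB (Kernel.aemeasurable _), smul_eq_mul]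
  refine (lintegral_const_mul_le _ _).trans (lintegral_mono fun s => ?_)
  have := pow_mul_lintegral_episodeFrom_le hrew h π n s (measurable_one.indicator hB)
  simpa [lintegral_indicator_one hB] using this

end MDP

/-! ### Chi-square bounds for episodes and datasets of tilted instances. -/

namespace MDP

variable {S A : Type*} [MeasurableSpace S] [MeasurableSpace A]

section chiSquare

variable (M : MDP S A) (ν : Measure S) [IsProbabilityMeasure ν] {δ : S × A → ℝ≥0∞}
  (hδ : Measurable δ) (hδ1 : ∀ x, δ x ≤ 1) {k : NNReal} {θ : ℝ≥0∞}
  (πb : Kernel S A) [IsMarkovKernel πb]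

/-- The chi-square bound for the law of an episode of a tilted instance. -/
theorem lintegral_episodeFrom_tilt_sq_le
    (hν : ∀ s, ∀ᵐ a ∂(πb s), ν ≤ k • M.trans (s, a)) (hθ : ∀ x, (1 + δ x * k) ^ 2 ≤ θ)
    (h1 : 1 ≤ θ) (n : ℕ) (s : S) {F : (Fin (n + 1) → (S × A) × ℝ) → ℝ≥0∞} (hF : Measurable F) :
    (∫⁻ τ, F τ ∂((M.tilt ν δ hδ hδ1).episodeFrom πb n s)) ^ 2 ≤
      (1 + θ ^ n * ∫⁻ τ, ∑ h : Fin n, k * δ (τ h.castSucc).1 ^ 2 ∂(M.episodeFrom πb n s)) *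
        ∫⁻ τ, F τ ^ 2 ∂(M.episodeFrom πb n s) := by
  have hact : (M.tilt ν δ hδ hδ1).actLaw πb = M.actLaw πb := rfl
  induction n generalizing s with
  | zero =>
    rw [lintegral_episodeFrom_zero _ _ _ hF, lintegral_episodeFrom_zero _ _ _ (hF.pow_const 2), hact]
    simp only [Finset.univ_eq_empty, Finset.sum_empty, lintegral_zero, mul_zero, add_zero]
    have hm : Measurable fun q : A × ℝ => F (fun _ => ((s, q.1), q.2)) ^ 2 := by fun_prop
    have := lintegral_sq_le_mul_of_sq_le (μ := M.actLaw πb s)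
      (g := fun q => F (fun _ => ((s, q.1), q.2))) (w := fun _ => 1) aemeasurable_const
      hm.aemeasurable (Filter.Eventually.of_forall fun q => by simp)
    simpa using this
  | succ n ih =>
    have hS : Measurable fun τ : Fin (n + 1) → (S × A) × ℝ =>
        ∑ h : Fin n, (k : ℝ≥0∞) * δ (τ h.castSucc).1 ^ 2 := by fun_prop
    -- The chi-square excess of the remaining episode, as given by the induction hypothesis. The sum
    -- omits the last step, after which no transition takes place.
    set D : S → ℝ≥0∞ := fun s => θ ^ n *
      ∫⁻ τ, ∑ h : Fin n, k * δ (τ h.castSucc).1 ^ 2 ∂(M.episodeFrom πb n s)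
    have hD : Measurable D := (Measurable.lintegral_kernel hS).const_mul _
    have hc : Measurable fun w : ((A × ℝ) × S) × (Fin (n + 1) → (S × A) × ℝ) =>
        F (Fin.cons ((s, w.1.1.1), w.1.1.2) w.2 : Fin (n + 2) → (S × A) × ℝ) :=
      hF.comp ((measurable_finCons _).comp
        (by fun_prop : Measurable fun w : ((A × ℝ) × S) × (Fin (n + 1) → (S × A) × ℝ) =>
          (((s, w.1.1.1), w.1.1.2), w.2)))
    have hQ : Measurable fun w : (A × ℝ) × S => ∫⁻ τ,
        F (Fin.cons ((s, w.1.1), w.1.2) τ : Fin (n + 2) → (S × A) × ℝ) ^ 2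
          ∂(M.episodeFrom πb n w.2) :=
      Measurable.lintegral_kernel_prod_right
        (κ := (M.episodeFrom πb n).comap (fun w : (A × ℝ) × S => w.2) measurable_snd)
        (hc.pow_const 2)
    have hQ' : Measurable fun q : A × ℝ => ∫⁻ s', ∫⁻ τ,
        F (Fin.cons ((s, q.1), q.2) τ : Fin (n + 2) → (S × A) × ℝ) ^ 2
          ∂(M.episodeFrom πb n s') ∂(M.trans (s, q.1)) :=
      Measurable.lintegral_kernel_prod_right
        (κ := M.trans.comap (fun q : A × ℝ => (s, q.1)) (by fun_prop)) hQ
    have hW : Measurable fun q : A × ℝ =>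
        1 + (k * δ (s, q.1) ^ 2 + θ * ∫⁻ s', D s' ∂(M.trans (s, q.1))) := by
      have := (Measurable.lintegral_kernel (κ := M.trans) hD).comp
        (by fun_prop : Measurable fun q : A × ℝ => (s, q.1))
      simp only [Function.comp_def] at this
      fun_prop
    rw [lintegral_episodeFrom_succ _ _ _ _ hF, lintegral_episodeFrom_succ _ _ _ _ (hF.pow_const 2),
      hact]
    refine (lintegral_sq_le_mul_of_sq_le hW.aemeasurable hQ'.aemeasurable ?_).trans ?_
    · filter_upwards [M.ae_actLaw πb s (hν s)] with q hq
      refine lintegral_mixture_sq_le hq (hδ1 _) (hθ _) ?_ hD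
        (hQ.comp (by fun_prop : Measurable fun s' : S => (q, s'))) fun s' => ?_
      · exact Measurable.lintegral_kernel_prod_right
          (κ := (M.tilt ν δ hδ hδ1).episodeFrom πb n)
          (hc.comp (by fun_prop : Measurable fun w : S × (Fin (n + 1) → (S × A) × ℝ) =>
            ((q, w.1), w.2)))
      · exact ih s' (hc.comp (by fun_prop : Measurable fun τ : Fin (n + 1) → (S × A) × ℝ =>
            ((q, s), τ)))
    · gcongr
      rw [lintegral_add_left measurable_const, lintegral_const, measure_univ, mul_one]
      gcongr
      rw [M.lintegral_episodeFrom_succ_add πb n s (f := fun x => k * δ x ^ 2) (by fun_prop) hS]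
      · have hm : Measurable fun q : A × ℝ => k * δ (s, q.1) ^ 2 + ∫⁻ s', ∫⁻ τ,
            ∑ h : Fin n, (k : ℝ≥0∞) * δ (τ h.castSucc).1 ^ 2 ∂(M.episodeFrom πb n s')
              ∂(M.trans (s, q.1)) := by
          have := (Measurable.lintegral_kernel (κ := M.trans) (Measurable.lintegral_kernel
            (κ := M.episodeFrom πb n) hS)).comp (by fun_prop : Measurable fun q : A × ℝ => (s, q.1))
          simp only [Function.comp_def] at this
          fun_prop
        rw [← lintegral_const_mul _ hm]
        refine lintegral_mono fun q => ?_
        rw [mul_add]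
        refine add_le_add (le_mul_of_one_le_left zero_le (one_le_pow₀ h1)) ?_
        rw [pow_succ', mul_assoc]
        exact mul_le_mul_right
          (lintegral_const_mul _ (Measurable.lintegral_kernel hS)).le _
      · intro z τ
        rw [Fin.sum_univ_succ]
        rfl

theorem lintegral_episode_tilt_sq_le
    (hν : ∀ s, ∀ᵐ a ∂(πb s), ν ≤ k • M.trans (s, a)) (hθ : ∀ x, (1 + δ x * k) ^ 2 ≤ θ)
    (h1 : 1 ≤ θ) (ξ : Measure S) [IsProbabilityMeasure ξ] (n : ℕ)
    {F : (Fin (n + 1) → (S × A) × ℝ) → ℝ≥0∞} (hF : Measurable F) :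
    (∫⁻ τ, F τ ∂((M.tilt ν δ hδ hδ1).episode πb ξ n)) ^ 2 ≤
      (1 + θ ^ n * ∫⁻ τ, ∑ h : Fin n, k * δ (τ h.castSucc).1 ^ 2 ∂(M.episode πb ξ n)) *
        ∫⁻ τ, F τ ^ 2 ∂(M.episode πb ξ n) := by
  have hS : Measurable fun τ : Fin (n + 1) → (S × A) × ℝ =>
      ∑ h : Fin n, (k : ℝ≥0∞) * δ (τ h.castSucc).1 ^ 2 := by fun_prop
  have hS' := Measurable.lintegral_kernel (κ := M.episodeFrom πb n) hS
  have hF' := Measurable.lintegral_kernel (κ := M.episodeFrom πb n) (hF.pow_const 2)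
  unfold episode
  rw [Measure.lintegral_bind (Kernel.aemeasurable _) hF.aemeasurable,
    Measure.lintegral_bind (Kernel.aemeasurable _) (hF.pow_const 2).aemeasurable,
    Measure.lintegral_bind (Kernel.aemeasurable _) hS.aemeasurable]
  refine (lintegral_sq_le_mul_of_sq_le (hS'.const_mul _ |>.const_add _).aemeasurable
    hF'.aemeasurable (Filter.Eventually.of_forall fun s =>
      M.lintegral_episodeFrom_tilt_sq_le ν hδ hδ1 πb hν hθ h1 n s hF)).trans ?_
  rw [lintegral_add_left measurable_const, lintegral_const, measure_univ, mul_one,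
    lintegral_const_mul _ hS']

instance (M : MDP S A) (π : Kernel S A) [IsMarkovKernel π] (ξ : Measure S) [IsProbabilityMeasure ξ]
    (n : ℕ) : IsProbabilityMeasure (M.episode π ξ n) := by
  unfold episode; infer_instance

theorem dataLaw_tilt_sq_le
    (hν : ∀ s, ∀ᵐ a ∂(πb s), ν ≤ k • M.trans (s, a)) (hθ : ∀ x, (1 + δ x * k) ^ 2 ≤ θ)
    (h1 : 1 ≤ θ) (ξ : Measure S) [IsProbabilityMeasure ξ] (H K : ℕ)
    {B : Set (Fin K → Fin (H + 1) → (S × A) × ℝ)} (hB : MeasurableSet B) :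
    ((M.tilt ν δ hδ hδ1).dataLaw πb ξ H K B) ^ 2 ≤
      (1 + θ ^ H * ∫⁻ τ, ∑ h : Fin H, k * δ (τ h.castSucc).1 ^ 2 ∂(M.episode πb ξ H)) ^ K *
        M.dataLaw πb ξ H K B := by
  have := lintegral_pi_sq_le (fun F hF =>
    M.lintegral_episode_tilt_sq_le ν hδ hδ1 πb hν hθ h1 ξ H hF) K (measurable_one.indicator hB)
  -- Indicators are idempotent, so the second moment under `M` becomes a probability.
  have hsq : ∀ D, (B.indicator (1 : (Fin K → Fin (H + 1) → (S × A) × ℝ) → ℝ≥0∞) D) ^ 2 = B.indicator 1 D := by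
    intro D; by_cases h : D ∈ B <;> simp [h]
  simp only [hsq, lintegral_indicator_one hB] at this
  exact this

end chiSquare

/-! ### The performance difference of two tilted instances. -/

/-- The expected sum of the weights `w` over the `n + 1` steps taken from `s`, as an extended
nonnegative number. -/
noncomputable def lvalue (M : MDP S A) (π : Kernel S A) (w : S × A → ℝ≥0∞) (n : ℕ) (s : S) : ℝ≥0∞ :=
  ∫⁻ τ, ∑ i, w (τ i).1 ∂(M.episodeFrom π n s)

theorem measurable_lvalue (M : MDP S A) (π : Kernel S A) {w : S × A → ℝ≥0∞} (hw : Measurable w)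
    (n : ℕ) : Measurable (M.lvalue π w n) :=
  Measurable.lintegral_kernel (by fun_prop)

theorem lvalue_succ (M : MDP S A) (π : Kernel S A) [IsMarkovKernel π] {w : S × A → ℝ≥0∞}
    (hw : Measurable w) (n : ℕ) (s : S) :
    M.lvalue π w (n + 1) s =
      ∫⁻ q, (w (s, q.1) + ∫⁻ s', M.lvalue π w n s' ∂(M.trans (s, q.1))) ∂(M.actLaw π s) := by
  rw [lvalue, M.lintegral_episodeFrom_succ_add π n s hw
    (by fun_prop : Measurable fun τ : Fin (n + 1) → (S × A) × ℝ => ∑ i, w (τ i).1)]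
  · rfl
  · intro z τ
    rw [Fin.sum_univ_succ]
    rfl

/-- The difference of the values of two tilted instances. -/
theorem lvalue_tilt_add_le (M : MDP S A) (π : Kernel S A) [IsMarkovKernel π]
    (ν₁ ν₂ : Measure S) [IsProbabilityMeasure ν₁] [IsProbabilityMeasure ν₂] {δ : S × A → ℝ≥0∞}
    (hδ : Measurable δ) (hδ1 : ∀ x, δ x ≤ 1) {w : S × A → ℝ≥0∞} (hw : Measurable w) {β : ℝ≥0∞}
    (H : ℕ)
    (hβ : ∀ n < H, ∫⁻ s, (M.tilt ν₂ δ hδ hδ1).lvalue π w n s ∂ν₂ + β * (n + 1 : ℕ) ≤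
      ∫⁻ s, (M.tilt ν₂ δ hδ hδ1).lvalue π w n s ∂ν₁) (n : ℕ) (hn : n ≤ H) (s : S) :
    (M.tilt ν₂ δ hδ hδ1).lvalue π w n s +
        β * ∫⁻ τ, ∑ h : Fin n, ((n - h : ℕ) : ℝ≥0∞) * δ (τ h.castSucc).1
          ∂((M.tilt ν₁ δ hδ hδ1).episodeFrom π n s) ≤
      (M.tilt ν₁ δ hδ hδ1).lvalue π w n s := by
  induction n generalizing s with
  | zero =>
    simp only [Finset.univ_eq_empty, Finset.sum_empty, lintegral_zero, mul_zero, add_zero]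
    rfl
  | succ n ih =>
    rw [lvalue_succ _ _ hw, lvalue_succ _ _ hw,
      lintegral_episodeFrom_succ_add _ π n s (f := fun x => (n + 1 : ℕ) * δ x) (by fun_prop)
        (by fun_prop : Measurable fun τ : Fin (n + 1) → (S × A) × ℝ =>
          ∑ h : Fin n, ((n - h : ℕ) : ℝ≥0∞) * δ (τ h.castSucc).1)]
    swap
    · intro z τ
      rw [Fin.sum_univ_succ]
      simp only [Fin.val_zero, Fin.castSucc_zero, Fin.cons_zero, Fin.val_succ, Nat.sub_zero,
        Nat.add_sub_add_right, ← Fin.succ_castSucc, Fin.cons_succ]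
    refine (add_le_add le_rfl (lintegral_const_mul_le _ _)).trans
      ((le_lintegral_add _ _).trans (lintegral_mono fun q => ?_))
    have hV := (M.tilt ν₂ δ hδ hδ1).measurable_lvalue π hw n
    set x := (s, q.1)
    set V₂ := (M.tilt ν₂ δ hδ hδ1).lvalue π w n
    set V₁ := (M.tilt ν₁ δ hδ hδ1).lvalue π w n
    set J : S → ℝ≥0∞ := fun s' => ∫⁻ τ, ∑ h : Fin n, ((n - h : ℕ) : ℝ≥0∞) * δ (τ h.castSucc).1
          ∂((M.tilt ν₁ δ hδ hδ1).episodeFrom π n s')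
    -- The performance difference splits in two: here the kernel is fixed and the later values
    -- change, by induction; in `h2` the value `V₂` is fixed and the kernel changes. The two kernels
    -- differ only in the part `δ x` sent to `ν₂` or to `ν₁`.
    have h1 : ∫⁻ s', V₂ s' ∂((M.tilt ν₁ δ hδ hδ1).trans x) +
        β * ∫⁻ s', J s' ∂((M.tilt ν₁ δ hδ hδ1).trans x) ≤
          ∫⁻ s', V₁ s' ∂((M.tilt ν₁ δ hδ hδ1).trans x) := by
      refine (add_le_add le_rfl (lintegral_const_mul_le _ _)).trans
        ((le_lintegral_add _ _).trans (lintegral_mono fun s' => ?_))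
      exact ih (by omega) s'
    have h2 : ∫⁻ s', V₂ s' ∂((M.tilt ν₂ δ hδ hδ1).trans x) + β * ((n + 1 : ℕ) * δ x) ≤
        ∫⁻ s', V₂ s' ∂((M.tilt ν₁ δ hδ hδ1).trans x) := by
      rw [lintegral_tilt_trans, lintegral_tilt_trans, add_assoc]
      gcongr
      calc _ = δ x * (∫⁻ s', V₂ s' ∂ν₂ + β * (n + 1 : ℕ)) := by ring
        _ ≤ _ := by gcongr; exact hβ n (by omega)
    calc _ = w x + ((∫⁻ s', V₂ s' ∂((M.tilt ν₂ δ hδ hδ1).trans x) + β * ((n + 1 : ℕ) * δ x)) +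
          β * ∫⁻ s', J s' ∂((M.tilt ν₁ δ hδ hδ1).trans x)) := by
          ring
      _ ≤ w x + (∫⁻ s', V₂ s' ∂((M.tilt ν₁ δ hδ hδ1).trans x) +
          β * ∫⁻ s', J s' ∂((M.tilt ν₁ δ hδ hδ1).trans x)) := by gcongr
      _ ≤ _ := by gcongr

end MDP

/-! ### The feature span and stability of the mismatch. -/

/-- Cauchy–Schwarz for the inner product of `C`, applied to `C⁻¹ x` and `w`, by the discriminant of
a nonnegative quadratic. It turns the bound on `φᵀ Σ⁻¹ φ` into a pointwise bound on functions of the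
span. -/
theorem Matrix.PosDef.sq_dotProduct_le {n : Type*} [Fintype n] [DecidableEq n]
    {C : Matrix n n ℝ} (hC : C.PosDef) (x w : n → ℝ) :
    (x ⬝ᵥ w) ^ 2 ≤ (x ⬝ᵥ C⁻¹.mulVec x) * (w ⬝ᵥ C.mulVec w) := by
  set z := C⁻¹.mulVec x
  have hdet : IsUnit C.det := hC.det_pos.ne'.isUnit
  have hz : C.mulVec z = x := by
    rw [Matrix.mulVec_mulVec, Matrix.mul_nonsing_inv _ hdet, Matrix.one_mulVec]
  have hsymm : z ⬝ᵥ C.mulVec w = x ⬝ᵥ w := by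
    rw [Matrix.dotProduct_mulVec, ← Matrix.mulVec_transpose,
      show C.transpose = C from hC.isHermitian, hz]
  have hwz : w ⬝ᵥ C.mulVec z = x ⬝ᵥ w := by rw [hz, dotProduct_comm]
  have hquad : ∀ t : ℝ, 0 ≤ (z ⬝ᵥ C.mulVec z) * (t * t) + (2 * (x ⬝ᵥ w)) * t +
      w ⬝ᵥ C.mulVec w := by
    intro t
    have h := hC.posSemidef.dotProduct_mulVec_nonneg (t • z + w)
    simp only [star_trivial, Matrix.mulVec_add, Matrix.mulVec_smul, dotProduct_add, add_dotProduct,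
      smul_dotProduct, dotProduct_smul, smul_eq_mul, hsymm, hwz] at h
    linarith
  have h := discrim_le_zero hquad
  rw [discrim, hz, dotProduct_comm z x] at h
  nlinarith

namespace MDP

variable {S A : Type*} [MeasurableSpace S] [MeasurableSpace A]

theorem integrable_episode_comp (M : MDP S A) (π : Kernel S A) [IsMarkovKernel π] (ξ : Measure S)
    [IsProbabilityMeasure ξ] (n : ℕ) (i : Fin (n + 1)) {f : S × A → ℝ} (hf : Measurable f) {B : ℝ}
    (hB : ∀ x, |f x| ≤ B) : Integrable (fun τ => f (τ i).1) (M.episode π ξ n) :=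
  Integrable.of_bound (hf.comp (by fun_prop : Measurable fun τ : Fin (n + 1) → (S × A) × ℝ =>
    (τ i).1)).aestronglyMeasurable B (Filter.Eventually.of_forall fun τ => hB _)

/-- A function in the span of the features is bounded by a multiple of its norm in `L²` of the
data. -/
theorem measurable_and_sq_le_of_mem_featureSpan (M : MDP S A) (πb : Kernel S A) [IsMarkovKernel πb]
    (ξb : Measure S) [IsProbabilityMeasure ξb] (H : ℕ) {d : ℕ} {φ : S × A → Fin d → ℝ}
    (hφ : Measurable φ) (hcov : (M.dataCov πb ξb H φ).PosDef) {B : ℝ}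
    (hB : ∀ x, dotProduct (φ x) (((M.dataCov πb ξb H φ)⁻¹).mulVec (φ x)) ≤ B)
    {f : S × A → ℝ} (hf : f ∈ featureSpan φ) :
    Measurable f ∧ ∀ x, f x ^ 2 ≤ B * M.dataMean πb ξb H fun x => f x ^ 2 := by
  set C := M.dataCov πb ξb H φ with hC
  obtain ⟨w, hw⟩ := (Submodule.mem_span_range_iff_exists_fun ℝ).1 hf
  have hfw : ∀ x, f x = φ x ⬝ᵥ w := by
    intro x
    rw [← hw, Finset.sum_apply]
    exact Finset.sum_congr rfl fun i _ => mul_comm _ _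
  have hφi : ∀ i, Measurable fun x => φ x i := fun i => (measurable_pi_apply i).comp hφ
  have hbound : ∀ x v, (φ x ⬝ᵥ v) ^ 2 ≤ B * (v ⬝ᵥ C.mulVec v) := fun x v =>
    (hcov.sq_dotProduct_le (φ x) v).trans (mul_le_mul_of_nonneg_right (hB x)
      (by simpa using hcov.posSemidef.dotProduct_mulVec_nonneg v))
  -- Basis vectors in `hbound` show that the features are bounded. This gives the integrability
  -- needed to expand `dataMean` of `f²` as a quadratic form in `C`.
  have hφb : ∀ i j, ∃ b, ∀ x, |φ x i * φ x j| ≤ b := by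
    intro i j
    refine ⟨B * C i i + B * C j j, fun x => ?_⟩
    have h1 := hbound x (Pi.single i 1)
    have h2 := hbound x (Pi.single j 1)
    simp only [dotProduct_single, mul_one, Matrix.mulVec_single, single_dotProduct] at h1 h2
    simp at h1 h2
    rw [abs_le]
    constructor <;> nlinarith [sq_nonneg (φ x i + φ x j), sq_nonneg (φ x i - φ x j)]
  refine ⟨?_, fun x => ?_⟩
  · rw [funext hfw]
    exact Finset.measurable_sum _ fun i _ => (hφi i).mul_const _
  · have hmean : M.dataMean πb ξb H (fun x => f x ^ 2) = w ⬝ᵥ C.mulVec w := by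
      have hint : ∀ i j (h : Fin H), Integrable (fun τ : Fin (H + 1) → (S × A) × ℝ =>
          φ (τ h.castSucc).1 i * φ (τ h.castSucc).1 j) (M.episode πb ξb H) := by
        intro i j h
        obtain ⟨b, hb⟩ := hφb i j
        exact M.integrable_episode_comp πb ξb H h.castSucc ((hφi i).mul (hφi j)) hb
      have hsq : ∀ y, f y ^ 2 = ∑ i, ∑ j, w i * w j * (φ y i * φ y j) := by
        intro y
        rw [hfw, sq, dotProduct, Finset.sum_mul_sum]
        exact Finset.sum_congr rfl fun i _ => Finset.sum_congr rfl fun j _ => by ring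
      have hswap : ∀ τ : Fin (H + 1) → (S × A) × ℝ,
          (1 / (H : ℝ)) * ∑ h : Fin H, f (τ h.castSucc).1 ^ 2 =
            ∑ i, ∑ j, w i * w j * ((1 / (H : ℝ)) * ∑ h : Fin H,
              φ (τ h.castSucc).1 i * φ (τ h.castSucc).1 j) := by
        intro τ
        simp only [hsq, Finset.mul_sum]
        rw [Finset.sum_comm]
        refine Finset.sum_congr rfl fun i _ => ?_
        rw [Finset.sum_comm]
        exact Finset.sum_congr rfl fun j _ => Finset.sum_congr rfl fun h _ => by ring
      have hint2 : ∀ i j, Integrable (fun τ : Fin (H + 1) → (S × A) × ℝ =>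
          w i * w j * ((1 / (H : ℝ)) * ∑ h : Fin H,
              φ (τ h.castSucc).1 i * φ (τ h.castSucc).1 j)) (M.episode πb ξb H) := fun i j =>
        ((integrable_finsetSum _ fun h _ => hint i j h).const_mul _).const_mul _
      unfold dataMean
      simp only [hswap]
      rw [integral_finsetSum _ fun i _ => integrable_finsetSum _ fun j _ => hint2 i j]
      have hdot : w ⬝ᵥ C.mulVec w = ∑ i, ∑ j, w i * (C i j * w j) := by
        simp only [dotProduct, Matrix.mulVec, Finset.mul_sum]
      rw [hdot]
      refine Finset.sum_congr rfl fun i _ => ?_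
      rw [integral_finsetSum _ fun j _ => hint2 i j]
      refine Finset.sum_congr rfl fun j _ => ?_
      rw [integral_const_mul, hC]
      simp only [dataCov, Matrix.of_apply, dataMean]
      ring
    rw [hmean, hfw]
    exact hbound x w

theorem dataMean_smul (M : MDP S A) (πb : Kernel S A) (ξb : Measure S) (H : ℕ) (a : ℝ)
    (f : S × A → ℝ) :
    M.dataMean πb ξb H (fun x => a * f x) = a * M.dataMean πb ξb H f := by
  unfold dataMean
  rw [← integral_const_mul]
  refine integral_congr_ae (Filter.Eventually.of_forall fun τ => ?_)
  simp only [← Finset.mul_sum]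
  ring

theorem weightedMean_smul (M : MDP S A) (π : Kernel S A) (ξ : Measure S) (H : ℕ) (a : ℝ)
    (f : S × A → ℝ) :
    M.weightedMean π ξ H (fun x => a * f x) = a * M.weightedMean π ξ H f := by
  unfold weightedMean
  rw [← integral_const_mul]
  refine integral_congr_ae (Filter.Eventually.of_forall fun τ => ?_)
  simp only [Finset.mul_sum]
  exact Finset.sum_congr rfl fun h _ => by ring

theorem dataMean_sq_nonneg (M : MDP S A) (πb : Kernel S A) (ξb : Measure S) (H : ℕ)
    (f : S × A → ℝ) : 0 ≤ M.dataMean πb ξb H fun x => f x ^ 2 :=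
  integral_nonneg fun τ => by positivity

theorem dataMean_nonneg_mul_le {M M' : MDP S A} {πb : Kernel S A} [IsMarkovKernel πb]
    {ξb : Measure S} [IsProbabilityMeasure ξb] {H : ℕ} {ρ : ℝ} (hρ : 0 ≤ ρ)
    (hle : ENNReal.ofReal ρ • M.episode πb ξb H ≤ M'.episode πb ξb H) {f : S × A → ℝ}
    (hf : Measurable f) {b : ℝ} (hb : ∀ x, f x ^ 2 ≤ b) :
    ρ * M.dataMean πb ξb H (fun x => f x ^ 2) ≤ M'.dataMean πb ξb H fun x => f x ^ 2 := by
  unfold dataMean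
  have h1 := integral_mono_measure (f := fun τ : Fin (H + 1) → (S × A) × ℝ =>
    (1 / (H : ℝ)) * ∑ h : Fin H, f (τ h.castSucc).1 ^ 2) hle
    (Filter.Eventually.of_forall fun τ => by simp only [Pi.zero_apply]; positivity)
    ((integrable_finsetSum _ fun h _ => M'.integrable_episode_comp πb ξb H h.castSucc
      (f := fun x => f x ^ 2) (hf.pow_const 2) (B := b)
      fun x => by rw [abs_of_nonneg (sq_nonneg _)]; exact hb x).const_mul _)
  rw [integral_smul_measure, ENNReal.toReal_ofReal hρ] at h1
  exact h1

/-- Domination of measures compares integrals of nonnegative functions only, and from below. Applied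
to the nonnegative function `H² b - G`, it gives an upper bound for the integral of `G`. -/
theorem weightedMean_le {M M' : MDP S A} {π : Kernel S A} [IsMarkovKernel π]
    {ξ : Measure S} [IsProbabilityMeasure ξ] {H : ℕ} {ρ : ℝ} (hρ : 0 ≤ ρ)
    (hle : ENNReal.ofReal ρ • M.episode π ξ H ≤ M'.episode π ξ H) {f : S × A → ℝ}
    (hf : Measurable f) {b : ℝ} (hb : ∀ x, |f x| ≤ b) :
    M'.weightedMean π ξ H f ≤ ρ * M.weightedMean π ξ H f + H ^ 2 * b * (1 - ρ) := by
  unfold weightedMean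
  set G : (Fin (H + 1) → (S × A) × ℝ) → ℝ := fun τ =>
    ∑ h : Fin H, ((H : ℝ) - (h : ℕ)) * f (τ h.castSucc).1
  have hG : ∀ N : MDP S A, Integrable G (N.episode π ξ H) := fun N =>
    integrable_finsetSum _ fun h _ =>
      (N.integrable_episode_comp π ξ H h.castSucc hf hb).const_mul _
  have hGb : ∀ τ, G τ ≤ H ^ 2 * b := by
    intro τ
    calc G τ ≤ ∑ _h : Fin H, (H : ℝ) * b := by
          refine Finset.sum_le_sum fun h _ => ?_
          have h1 : ((h : ℕ) : ℝ) < H := by exact_mod_cast h.2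
          have h2 : (0 : ℝ) ≤ (h : ℕ) := by positivity
          have h3 := abs_le.1 (hb (τ h.castSucc).1)
          have h4 : 0 ≤ b := (abs_nonneg _).trans (hb (τ h.castSucc).1)
          calc ((H : ℝ) - (h : ℕ)) * f (τ h.castSucc).1 ≤ ((H : ℝ) - (h : ℕ)) * b := by
                gcongr
                exact h3.2
            _ ≤ H * b := by gcongr; linarith
      _ = H ^ 2 * b := by simp; ring
  have h1 := integral_mono_measure (f := fun τ => H ^ 2 * b - G τ) hle
    (Filter.Eventually.of_forall fun τ => sub_nonneg.2 (hGb τ))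
    ((integrable_const _).sub (hG M'))
  rw [integral_smul_measure, ENNReal.toReal_ofReal hρ, integral_sub (integrable_const _) (hG M),
    integral_sub (integrable_const _) (hG M'), integral_const, integral_const] at h1
  simp only [probReal_univ, smul_eq_mul, one_mul] at h1
  linarith

/-- A bound for the mismatch of an instance whose episodes dominate those of an instance with
mismatch at most `R`. -/
theorem mismatch_le {M M' : MDP S A} {π πb : Kernel S A} [IsMarkovKernel π] [IsMarkovKernel πb]
    {ξ₀ ξb : Measure S} [IsProbabilityMeasure ξ₀] [IsProbabilityMeasure ξb] {H : ℕ}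
    {𝒬 : Submodule ℝ (S × A → ℝ)} {ρ : ℝ} (hρ : 0 < ρ)
    (hle₀ : ENNReal.ofReal ρ • M.episode π ξ₀ H ≤ M'.episode π ξ₀ H)
    (hleb : ENNReal.ofReal ρ • M.episode πb ξb H ≤ M'.episode πb ξb H) {b : ℝ}
    (h𝒬 : ∀ f ∈ 𝒬, Measurable f ∧ ∀ x, |f x| ≤ b * √(M.dataMean πb ξb H fun x => f x ^ 2))
    {R R' : ℝ} (hR : ∀ f ∈ 𝒬, M.weightedMean π ξ₀ H f ≤
      R * √(M.dataMean πb ξb H fun x => f x ^ 2))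
    (hR' : ρ * R + H ^ 2 * b * (1 - ρ) ≤ R' * √ρ) (hR'0 : 0 ≤ R') :
    M'.mismatch π πb ξ₀ ξb H 𝒬 ≤ ENNReal.ofReal R' := by
  refine iSup₂_le fun f hf => ENNReal.div_le_of_le_mul ?_
  rw [← ENNReal.ofReal_mul hR'0]
  refine ENNReal.ofReal_le_ofReal ?_
  obtain ⟨hfm, hfb⟩ := h𝒬 f hf
  set r := √(M.dataMean πb ξb H fun x => f x ^ 2)
  have hr : 0 ≤ r := Real.sqrt_nonneg _
  have h1 : √ρ * r ≤ √(M'.dataMean πb ξb H fun x => f x ^ 2) := by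
    rw [← Real.sqrt_mul hρ.le]
    refine Real.sqrt_le_sqrt (dataMean_nonneg_mul_le hρ.le hleb hfm (b := (b * r) ^ 2) fun x => ?_)
    exact sq_le_sq' (abs_le.1 (hfb x)).1 (abs_le.1 (hfb x)).2
  calc M'.weightedMean π ξ₀ H f
      ≤ ρ * M.weightedMean π ξ₀ H f + H ^ 2 * (b * r) * (1 - ρ) :=
        weightedMean_le hρ.le hle₀ hfm hfb
    _ ≤ ρ * (R * r) + H ^ 2 * (b * r) * (1 - ρ) := by gcongr; exact hR f hf
    _ = (ρ * R + H ^ 2 * b * (1 - ρ)) * r := by ring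
    _ ≤ (R' * √ρ) * r := by gcongr
    _ = R' * (√ρ * r) := by ring
    _ ≤ _ := by gcongr

/-- An upper bound for the mismatch bounds the weighted means in terms of the norm. -/
theorem weightedMean_le_of_mismatch_le {M : MDP S A} {π πb : Kernel S A}
    {ξ₀ ξb : Measure S} {H : ℕ} {𝒬 : Submodule ℝ (S × A → ℝ)} {b : ℝ}
    (h𝒬 : ∀ f ∈ 𝒬, ∀ x, |f x| ≤ b * √(M.dataMean πb ξb H fun x => f x ^ 2))
    {R : ℝ} (hR : M.mismatch π πb ξ₀ ξb H 𝒬 ≤ ENNReal.ofReal R) (hR0 : 0 ≤ R)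
    {f : S × A → ℝ} (hf : f ∈ 𝒬) :
    M.weightedMean π ξ₀ H f ≤ R * √(M.dataMean πb ξb H fun x => f x ^ 2) := by
  -- A vanishing norm forces `f = 0` everywhere by the pointwise bound, so the only zero
  -- denominators are quotients `0 / 0`.
  rcases (Real.sqrt_nonneg (M.dataMean πb ξb H fun x => f x ^ 2)).eq_or_lt with h0 | h0
  · have hz : ∀ x, f x = 0 := fun x => by
      have := h𝒬 f hf x
      rw [← h0, mul_zero] at this
      exact abs_nonpos_iff.1 this
    rw [← h0]
    simp [weightedMean, hz]
  · have h1 := (le_iSup₂ (f := fun f (_ : f ∈ 𝒬) => ENNReal.ofReal (M.weightedMean π ξ₀ H f) /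
      ENNReal.ofReal (√(M.dataMean πb ξb H fun x => f x ^ 2))) f hf).trans hR
    rw [← ENNReal.ofReal_div_of_pos h0] at h1
    exact (div_le_iff₀ h0).1 ((ENNReal.ofReal_le_ofReal_iff hR0).1 h1)

end MDP

/-! ### The two-point testing bound. -/

/-- Two measures that satisfy a chi-square bound with respect to a third one cannot be told apart
with small errors. -/
theorem le_measure_or_le_measure_of_sq_le {Ω : Type*} [MeasurableSpace Ω] {P P₁ P₂ : Measure Ω}
    [IsProbabilityMeasure P] [IsProbabilityMeasure P₁] [IsProbabilityMeasure P₂] {C : ℝ≥0∞}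
    (hC : C ≤ ENNReal.ofReal (13 / 10))
    (h₁ : ∀ B, MeasurableSet B → P₁ B ^ 2 ≤ C * P B)
    (h₂ : ∀ B, MeasurableSet B → P₂ B ^ 2 ≤ C * P B)
    {B₁ B₂ : Set Ω} (hB₁ : MeasurableSet B₁) (hsub : B₁ᶜ ⊆ B₂) :
    1 / 6 ≤ P₁ B₁ ∨ 1 / 6 ≤ P₂ B₂ := by
  by_contra! hcon
  have hreal : ∀ Q : Measure Ω, (∀ B, MeasurableSet B → Q B ^ 2 ≤ C * P B) →
      ∀ B, MeasurableSet B → Q.real B ^ 2 ≤ 13 / 10 * P.real B := by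
    intro Q hQ B hB
    have h : Q B ^ 2 ≤ ENNReal.ofReal (13 / 10) * P B := (hQ B hB).trans (by gcongr)
    have := ENNReal.toReal_mono (by finiteness) h
    rwa [ENNReal.toReal_pow, ENNReal.toReal_mul, ENNReal.toReal_ofReal (by norm_num)] at this
  have hlt : ∀ Q : Measure Ω, ∀ B, Q B < 1 / 6 → Q.real B < 1 / 6 := by
    intro Q B h
    have := ENNReal.toReal_strict_mono (by norm_num) h
    simpa [measureReal_def] using this
  have e1 := hreal P₁ h₁ B₁ᶜ hB₁.compl
  have e2 := hreal P₂ h₂ B₁ hB₁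
  have e3 := hlt P₁ B₁ hcon.1
  have e4 := hlt P₂ B₂ hcon.2
  have e5 : P₂.real B₁ᶜ ≤ P₂.real B₂ := measureReal_mono hsub
  have e6 := probReal_compl_eq_one_sub (μ := P₁) hB₁
  have e7 := probReal_compl_eq_one_sub (μ := P₂) hB₁
  have e8 := probReal_compl_eq_one_sub (μ := P) hB₁
  -- Adding the bounds for `B₁ᶜ` and `B₁` would give `2 (5/6)² = 25/18 ≤ 13/10`, which is false.
  have e9 : (5 / 6 : ℝ) ^ 2 ≤ P₁.real B₁ᶜ ^ 2 := by gcongr; linarith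
  have e10 : (5 / 6 : ℝ) ^ 2 ≤ P₂.real B₁ ^ 2 := by gcongr; linarith
  linarith

/-! ### The value gap between the two rivals. -/

namespace MDP

variable {S A : Type*} [MeasurableSpace S] [MeasurableSpace A]

theorem meanReward_mem (M : MDP S A) (x : S × A) : M.meanReward x ∈ Set.Icc (0 : ℝ) 1 := by
  have h := M.rew_mem x
  refine ⟨integral_nonneg_of_ae (h.mono fun y hy => hy.1), ?_⟩
  calc M.meanReward x ≤ ∫ _, (1 : ℝ) ∂(M.rew x) :=
        integral_mono_of_nonneg (h.mono fun y hy => hy.1) (integrable_const _)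
          (h.mono fun y hy => hy.2)
    _ = 1 := by simp

theorem measurable_meanReward (M : MDP S A) : Measurable M.meanReward :=
  (StronglyMeasurable.integral_kernel (κ := M.rew) stronglyMeasurable_id).measurable

theorem ofReal_integral_sum_meanReward (M : MDP S A) {n : ℕ}
    (μ : Measure (Fin (n + 1) → (S × A) × ℝ)) [IsProbabilityMeasure μ] :
    ENNReal.ofReal (∫ τ, ∑ i, M.meanReward (τ i).1 ∂μ) =
      ∫⁻ τ, ∑ i, ENNReal.ofReal (M.meanReward (τ i).1) ∂μ := by
  have hm := M.measurable_meanReward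
  rw [ofReal_integral_eq_lintegral_ofReal]
  · refine lintegral_congr fun τ => ?_
    rw [ENNReal.ofReal_sum_of_nonneg fun i _ => (M.meanReward_mem _).1]
  · refine integrable_finsetSum _ fun i _ => Integrable.of_bound
      (hm.comp (by fun_prop : Measurable fun τ : Fin (n + 1) → (S × A) × ℝ =>
        (τ i).1)).aestronglyMeasurable 1 (Filter.Eventually.of_forall fun τ => ?_)
    rw [Real.norm_eq_abs, abs_of_nonneg (M.meanReward_mem _).1]
    exact (M.meanReward_mem _).2
  · exact Filter.Eventually.of_forall fun τ => Finset.sum_nonneg fun i _ => (M.meanReward_mem _).1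

theorem ofReal_stateValue (M : MDP S A) (π : Kernel S A) [IsMarkovKernel π] (H h : ℕ) (s : S) :
    ENNReal.ofReal (M.stateValue π H h s) =
      M.lvalue π (fun x => ENNReal.ofReal (M.meanReward x)) (H - h) s :=
  M.ofReal_integral_sum_meanReward _

theorem ofReal_value (M : MDP S A) (π : Kernel S A) [IsMarkovKernel π] (ξ : Measure S)
    [IsProbabilityMeasure ξ] (H : ℕ) :
    ENNReal.ofReal (M.value π ξ H) =
      ∫⁻ s, M.lvalue π (fun x => ENNReal.ofReal (M.meanReward x)) H s ∂ξ := by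
  have hm := M.measurable_meanReward
  rw [value, ofReal_integral_sum_meanReward, episode,
    Measure.lintegral_bind (Kernel.aemeasurable _) (by fun_prop : Measurable fun τ :
      Fin (H + 1) → (S × A) × ℝ => ∑ i, ENNReal.ofReal (M.meanReward (τ i).1)).aemeasurable]
  rfl

theorem value_nonneg (M : MDP S A) (π : Kernel S A) (ξ : Measure S) (H : ℕ) :
    0 ≤ M.value π ξ H :=
  integral_nonneg fun _ => Finset.sum_nonneg fun _ _ => (M.meanReward_mem _).1

/-- Domination bounds values of a tilt only from below. Passing to the complementary reward `1 - r`
converts such a bound into one from above. -/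
theorem lvalue_add_lvalue_compl (M : MDP S A) (π : Kernel S A) [IsMarkovKernel π]
    {r : S × A → ℝ} (hr : Measurable r) (h01 : ∀ x, r x ∈ Set.Icc (0 : ℝ) 1) (n : ℕ) (s : S) :
    M.lvalue π (fun x => ENNReal.ofReal (r x)) n s +
      M.lvalue π (fun x => ENNReal.ofReal (1 - r x)) n s = ENNReal.ofReal (n + 1) := by
  unfold lvalue
  rw [← lintegral_add_left (by fun_prop)]
  simp only [← Finset.sum_add_distrib]
  have : ∀ x, ENNReal.ofReal (r x) + ENNReal.ofReal (1 - r x) = 1 := fun x => by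
    rw [← ENNReal.ofReal_add (h01 x).1 (by linarith [(h01 x).2])]; simp
  simp only [this]
  rw [lintegral_const, measure_univ, mul_one, Finset.sum_const, Finset.card_univ, Fintype.card_fin,
    ← Nat.cast_succ, ENNReal.ofReal_natCast]
  simp

section tilt

variable (M : MDP S A) (π : Kernel S A) [IsMarkovKernel π] {δ : S × A → ℝ≥0∞}
  (hδ : Measurable δ) (hδ1 : ∀ x, δ x ≤ 1) {η : ℝ}

theorem smul_trans_le_tilt_trans (ν : Measure S) [IsProbabilityMeasure ν] (hη : 0 ≤ η)
    (hδη : ∀ x, δ x ≤ ENNReal.ofReal η) (x : S × A) :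
    ENNReal.ofReal (1 - η) • M.trans x ≤ (M.tilt ν δ hδ hδ1).trans x := by
  rw [tilt_trans, ENNReal.ofReal_sub _ hη, ENNReal.ofReal_one]
  refine Measure.le_iff.2 fun B _ => ?_
  simp only [Measure.coe_add, Measure.coe_smul, Pi.add_apply, Pi.smul_apply, smul_eq_mul]
  refine le_trans ?_ le_self_add
  gcongr
  exact hδη x

theorem ofReal_smul_episode_le_tilt (ν : Measure S) [IsProbabilityMeasure ν] (hη : 0 ≤ η)
    (hη1 : η ≤ 1) (hδη : ∀ x, δ x ≤ ENNReal.ofReal η) (ξ : Measure S) (n : ℕ) :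
    ENNReal.ofReal ((1 - η) ^ n) • M.episode π ξ n ≤ (M.tilt ν δ hδ hδ1).episode π ξ n := by
  rw [ENNReal.ofReal_pow (by linarith)]
  exact smul_episode_le (M := M) (M' := M.tilt ν δ hδ hδ1) rfl (M.smul_trans_le_tilt_trans hδ hδ1 ν hη hδη) π ξ n

theorem ofReal_mul_lvalue_le_tilt (ν : Measure S) [IsProbabilityMeasure ν] (hη : 0 ≤ η)
    (hη1 : η ≤ 1) (hδη : ∀ x, δ x ≤ ENNReal.ofReal η) {H n : ℕ} (hn : n ≤ H)
    {w : S × A → ℝ≥0∞} (hw : Measurable w) (s : S) :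
    ENNReal.ofReal ((1 - η) ^ H) * M.lvalue π w n s ≤ (M.tilt ν δ hδ hδ1).lvalue π w n s := by
  refine le_trans ?_ (pow_mul_lintegral_episodeFrom_le (M := M)
    (M' := M.tilt ν δ hδ hδ1) rfl
    (M.smul_trans_le_tilt_trans hδ hδ1 ν hη hδη) π n s
    (by fun_prop : Measurable fun τ : Fin (n + 1) → (S × A) × ℝ => ∑ i, w (τ i).1))
  rw [← ENNReal.ofReal_pow (by linarith)]
  refine mul_le_mul_left (ENNReal.ofReal_le_ofReal ?_) _
  exact pow_le_pow_of_le_one (by linarith) (by linarith) hn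

/-- The values of the instances tilted towards high-value and towards low-value states. -/
theorem value_tilt_add_le (ν₁ ν₂ : Measure S) [IsProbabilityMeasure ν₁] [IsProbabilityMeasure ν₂]
    (hη : 0 ≤ η) (hη1 : η ≤ 1) (hδη : ∀ x, δ x ≤ ENNReal.ofReal η) (H : ℕ)
    (hhi : ∀ᵐ s ∂ν₁, ∀ h ≤ H, 3 / 4 * ((H : ℝ) - h + 1) ≤ M.stateValue π H h s)
    (hlo : ∀ᵐ s ∂ν₂, ∀ h ≤ H, M.stateValue π H h s ≤ 1 / 4 * ((H : ℝ) - h + 1))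
    (hβ : 0 ≤ 3 / 2 * (1 - η) ^ H - 1) (ξ : Measure S) [IsProbabilityMeasure ξ] {W : ℝ}
    (hW0 : 0 ≤ W)
    (hW : ENNReal.ofReal W ≤ ∫⁻ τ, ∑ h : Fin H, ((H - h : ℕ) : ℝ≥0∞) * δ (τ h.castSucc).1
      ∂(M.episode π ξ H)) :
    (M.tilt ν₂ δ hδ hδ1).value π ξ H + (3 / 2 * (1 - η) ^ H - 1) * ((1 - η) ^ H * W) ≤
      (M.tilt ν₁ δ hδ hδ1).value π ξ H := by
  set ρ := (1 - η) ^ H with hρ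
  have hρ0 : 0 ≤ ρ := pow_nonneg (by linarith) _
  have hrm := M.measurable_meanReward
  have hr := M.meanReward_mem
  set w : S × A → ℝ≥0∞ := fun x => ENNReal.ofReal (M.meanReward x) with hw
  have hwm : Measurable w := by fun_prop
  have hsteps : ∀ n < H, ((H : ℝ) - (H - n : ℕ) + 1) = n + 1 := fun n hn => by
    rw [Nat.cast_sub hn.le]; ring
  have hstate : ∀ n < H, ∀ s, ENNReal.ofReal (M.stateValue π H (H - n) s) = M.lvalue π w n s := by
    intro n hn s
    rw [ofReal_stateValue, Nat.sub_sub_self hn.le]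
  -- Per remaining step, the value is at least `3/4 ρ` on the high states and at most `1 - 3/4 ρ` on
  -- the low ones, the latter through the complementary reward. The difference is `3/2 ρ - 1`, which
  -- tends to `1/2`.
  have hgain : ∀ n < H, ∫⁻ s, (M.tilt ν₂ δ hδ hδ1).lvalue π w n s ∂ν₂ +
      ENNReal.ofReal (3 / 2 * ρ - 1) * (n + 1 : ℕ) ≤
      ∫⁻ s, (M.tilt ν₂ δ hδ hδ1).lvalue π w n s ∂ν₁ := by
    intro n hn
    have h1 : ENNReal.ofReal (3 / 4 * ρ * (n + 1)) ≤
        ∫⁻ s, (M.tilt ν₂ δ hδ hδ1).lvalue π w n s ∂ν₁ := by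
      calc ENNReal.ofReal (3 / 4 * ρ * (n + 1))
          = ∫⁻ _, ENNReal.ofReal (3 / 4 * ρ * (n + 1)) ∂ν₁ := by simp
        _ ≤ _ := by
          refine lintegral_mono_ae (hhi.mono fun s hs => ?_)
          refine le_trans ?_ (M.ofReal_mul_lvalue_le_tilt π hδ hδ1 ν₂ hη hη1 hδη hn.le hwm s)
          rw [← hstate n hn, ← ENNReal.ofReal_mul hρ0]
          refine ENNReal.ofReal_le_ofReal ?_
          have h2 := hs (H - n) (Nat.sub_le _ _)
          rw [hsteps n hn] at h2
          calc 3 / 4 * ρ * (n + 1) = ρ * (3 / 4 * (n + 1)) := by ring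
            _ ≤ _ := by gcongr
    have h2 : ∫⁻ s, (M.tilt ν₂ δ hδ hδ1).lvalue π w n s ∂ν₂ ≤
        ENNReal.ofReal ((1 - 3 / 4 * ρ) * (n + 1)) := by
      calc ∫⁻ s, (M.tilt ν₂ δ hδ hδ1).lvalue π w n s ∂ν₂
          ≤ ∫⁻ _, ENNReal.ofReal ((1 - 3 / 4 * ρ) * (n + 1)) ∂ν₂ := by
            refine lintegral_mono_ae (hlo.mono fun s hs => ?_)
            have h3 := hs (H - n) (Nat.sub_le _ _)
            rw [hsteps n hn] at h3
            have h4 := M.ofReal_mul_lvalue_le_tilt π hδ hδ1 ν₂ hη hη1 hδη hn.le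
              (by fun_prop : Measurable fun x => ENNReal.ofReal (1 - M.meanReward x)) s
            have h5 := M.lvalue_add_lvalue_compl π hrm hr n s
            have h6 := (M.tilt ν₂ δ hδ hδ1).lvalue_add_lvalue_compl π hrm hr n s
            have h7 : M.lvalue π w n s ≤ ENNReal.ofReal (1 / 4 * (n + 1)) := by
              rw [← hstate n hn]; exact ENNReal.ofReal_le_ofReal h3
            simp only [← hw] at h5 h6
            set a := (M.tilt ν₂ δ hδ hδ1).lvalue π w n s
            set a' := (M.tilt ν₂ δ hδ hδ1).lvalue π (fun x => ENNReal.ofReal (1 - M.meanReward x)) n s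
            set e := M.lvalue π w n s
            set e' := M.lvalue π (fun x => ENNReal.ofReal (1 - M.meanReward x)) n s
            have hfin : ∀ x y : ℝ≥0∞, x + y = ENNReal.ofReal (n + 1) →
                x ≠ ∞ ∧ y ≠ ∞ ∧ x.toReal + y.toReal = n + 1 := by
              intro x y h
              have hx := ne_top_of_le_ne_top ENNReal.ofReal_ne_top (h ▸ le_self_add)
              have hy := ne_top_of_le_ne_top ENNReal.ofReal_ne_top (h ▸ le_add_self)
              refine ⟨hx, hy, ?_⟩
              rw [← ENNReal.toReal_add hx hy, h, ENNReal.toReal_ofReal (by positivity)]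
            obtain ⟨he, he', hee⟩ := hfin _ _ h5
            obtain ⟨ha, ha', haa⟩ := hfin _ _ h6
            have h8 := ENNReal.toReal_mono ha' h4
            rw [ENNReal.toReal_mul, ENNReal.toReal_ofReal hρ0] at h8
            have h9 := ENNReal.toReal_le_of_le_ofReal (by positivity) h7
            rw [ENNReal.le_ofReal_iff_toReal_le ha]
            · have h10 : ρ * (3 / 4 * (n + 1)) ≤ ρ * e'.toReal := by gcongr; linarith
              linarith
            · have : ρ ≤ 1 := pow_le_one₀ (by linarith) (by linarith)
              have : 0 ≤ 1 - 3 / 4 * ρ := by linarith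
              positivity
        _ = _ := by simp
    refine le_trans ?_ h1
    calc _ ≤ ENNReal.ofReal ((1 - 3 / 4 * ρ) * (n + 1)) +
          ENNReal.ofReal (3 / 2 * ρ - 1) * (n + 1 : ℕ) := by gcongr
      _ = ENNReal.ofReal ((1 - 3 / 4 * ρ) * (n + 1) + (3 / 2 * ρ - 1) * (n + 1 : ℕ)) := by
          have : ρ ≤ 1 := pow_le_one₀ (by linarith) (by linarith)
          have : 0 ≤ 1 - 3 / 4 * ρ := by linarith
          rw [ENNReal.ofReal_add (by positivity) (by positivity), ENNReal.ofReal_mul hβ,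
            ENNReal.ofReal_natCast]
      _ ≤ _ := by
          refine ENNReal.ofReal_le_ofReal (le_of_eq ?_)
          push_cast
          ring
  have hmain := lintegral_mono (μ := ξ) fun s =>
    M.lvalue_tilt_add_le π ν₁ ν₂ hδ hδ1 hwm H hgain H le_rfl s
  have hG : Measurable fun τ : Fin (H + 1) → (S × A) × ℝ =>
      ∑ h : Fin H, ((H - h : ℕ) : ℝ≥0∞) * δ (τ h.castSucc).1 := by fun_prop
  -- The performance difference averages `δ` over episodes of the tilted instance; returning to
  -- episodes of `M` costs a second factor `ρ`.
  have hlow : ENNReal.ofReal (ρ * W) ≤ ∫⁻ s, ∫⁻ τ, ∑ h : Fin H, ((H - h : ℕ) : ℝ≥0∞) *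
      δ (τ h.castSucc).1 ∂((M.tilt ν₁ δ hδ hδ1).episodeFrom π H s) ∂ξ := by
    rw [← Measure.lintegral_bind (Kernel.aemeasurable _) hG.aemeasurable, ENNReal.ofReal_mul hρ0]
    calc _ ≤ ENNReal.ofReal ρ * ∫⁻ τ, ∑ h : Fin H, ((H - h : ℕ) : ℝ≥0∞) * δ (τ h.castSucc).1
            ∂(M.episode π ξ H) := by gcongr
      _ = ∫⁻ τ, ∑ h : Fin H, ((H - h : ℕ) : ℝ≥0∞) * δ (τ h.castSucc).1
            ∂(ENNReal.ofReal ρ • M.episode π ξ H) := by rw [lintegral_smul_measure]; rfl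
      _ ≤ _ := lintegral_mono' (M.ofReal_smul_episode_le_tilt π hδ hδ1 ν₁ hη hη1 hδη ξ H) le_rfl
  have hV : Measurable fun s => (M.tilt ν₂ δ hδ hδ1).lvalue π w H s := measurable_lvalue _ π hwm H
  rw [lintegral_add_left hV, lintegral_const_mul' _ _ ENNReal.ofReal_ne_top] at hmain
  have hfinal : ENNReal.ofReal ((M.tilt ν₂ δ hδ hδ1).value π ξ H) +
      ENNReal.ofReal (3 / 2 * ρ - 1) * ENNReal.ofReal (ρ * W) ≤
        ENNReal.ofReal ((M.tilt ν₁ δ hδ hδ1).value π ξ H) := by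
    rw [ofReal_value, ofReal_value]
    refine le_trans ?_ hmain
    gcongr
    rfl
  rw [← ENNReal.ofReal_mul hβ, ← ENNReal.ofReal_add (value_nonneg _ _ _ _) (by positivity)] at hfinal
  exact (ENNReal.ofReal_le_ofReal_iff (value_nonneg _ _ _ _)).1 hfinal

end tilt

end MDP

/-! ### Constants and the choice of the perturbation. -/

/-- For a small perturbation size `η`, the constants that depend on it are close to their limits. -/
theorem exists_pos_forall_le_perturbation {R c : ℝ} (hR : 0 < R) (G : ℝ) (H : ℕ) :
    ∃ η₀ > 0, ∀ η, 0 ≤ η → η ≤ η₀ → η < 1 ∧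
      (1 - η) ^ H * R + G * (1 - (1 - η) ^ H) ≤ 101 / 100 * R * √((1 - η) ^ H) ∧
      499 / 1000 ≤ (3 / 2 * (1 - η) ^ H - 1) * (1 - η) ^ H ∧ 0 ≤ 3 / 2 * (1 - η) ^ H - 1 ∧
      ((1 + η / c) ^ 2) ^ H ≤ 2 := by
  -- Every inequality is strict at `η = 0` and both sides are continuous there.
  have h1 : ∀ᶠ η : ℝ in nhds 0, η < 1 := eventually_lt_nhds zero_lt_one
  have h2 : ∀ᶠ η : ℝ in nhds 0, (1 - η) ^ H * R + G * (1 - (1 - η) ^ H) <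
      101 / 100 * R * √((1 - η) ^ H) :=
    (isOpen_lt (by fun_prop) (by fun_prop)).mem_nhds (by simp; linarith)
  have h3 : ∀ᶠ η : ℝ in nhds 0, 499 / 1000 < (3 / 2 * (1 - η) ^ H - 1) * (1 - η) ^ H :=
    (isOpen_lt (by fun_prop) (by fun_prop)).mem_nhds (by simp; norm_num)
  have h4 : ∀ᶠ η : ℝ in nhds 0, 0 < 3 / 2 * (1 - η) ^ H - 1 :=
    (isOpen_lt (by fun_prop) (by fun_prop)).mem_nhds (by simp; norm_num)
  have h5 : ∀ᶠ η : ℝ in nhds 0, ((1 + η / c) ^ 2) ^ H < 2 :=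
    (isOpen_lt (by fun_prop) (by fun_prop)).mem_nhds (by simp)
  obtain ⟨e, he, h⟩ := Metric.eventually_nhds_iff.1 (h1.and (h2.and (h3.and (h4.and h5))))
  refine ⟨e / 2, by positivity, fun η h0 hη => ?_⟩
  obtain ⟨g1, g2, g3, g4, g5⟩ := h (y := η) (by rw [Real.dist_eq, sub_zero, abs_of_nonneg h0]; linarith)
  exact ⟨g1, g2.le, g3.le, g4.le, g5.le⟩

/-- Conditioning a measure below `p` on a set of mass at least `c` gives a measure below
`c⁻¹ p`. -/
theorem cond_le_smul {S : Type*} [MeasurableSpace S] {m p : Measure S} (hmp : m ≤ p) {B : Set S}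
    {c : ℝ} (hc : 0 < c) (hB : ENNReal.ofReal c ≤ m B) : m[|B] ≤ c⁻¹.toNNReal • p := by
  refine Measure.le_iff.2 fun E _ => ?_
  change (m B)⁻¹ * m.restrict B E ≤ ENNReal.ofReal c⁻¹ * p E
  rw [ENNReal.ofReal_inv_of_pos hc]
  gcongr
  exact Measure.restrict_le_self.trans hmp

namespace MDP

variable {S A : Type*} [MeasurableSpace S] [MeasurableSpace A]

instance (M : MDP S A) (πb : Kernel S A) [IsMarkovKernel πb] (ξb : Measure S)
    [IsProbabilityMeasure ξb] (H K : ℕ) : IsProbabilityMeasure (M.dataLaw πb ξb H K) := by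
  unfold dataLaw; infer_instance

/-- A tilt must be nonnegative, so `f` is replaced by its positive part. As the weights `H - h` are
nonnegative, this can only raise the weighted mean. -/
theorem ofReal_weightedMean_le (M : MDP S A) (π : Kernel S A) [IsMarkovKernel π] (ξ : Measure S)
    [IsProbabilityMeasure ξ] (H : ℕ) {f : S × A → ℝ} (hf : Measurable f) {b : ℝ}
    (hb : ∀ x, |f x| ≤ b) :
    ENNReal.ofReal (M.weightedMean π ξ H f) ≤
      ∫⁻ τ, ∑ h : Fin H, ((H - h : ℕ) : ℝ≥0∞) * ENNReal.ofReal (f (τ h.castSucc).1)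
        ∂(M.episode π ξ H) := by
  have hint : Integrable (fun τ : Fin (H + 1) → (S × A) × ℝ =>
      ∑ h : Fin H, ((H : ℝ) - (h : ℕ)) * f (τ h.castSucc).1) (M.episode π ξ H) :=
    integrable_finsetSum _ fun h _ =>
      (M.integrable_episode_comp π ξ H h.castSucc hf hb).const_mul _
  have h1 : ENNReal.ofReal (M.weightedMean π ξ H f) ≤ ∫⁻ τ, ENNReal.ofReal
      (∑ h : Fin H, ((H : ℝ) - (h : ℕ)) * f (τ h.castSucc).1) ∂(M.episode π ξ H) := by
    refine ENNReal.ofReal_le_of_le_toReal ?_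
    rw [weightedMean, integral_eq_lintegral_pos_part_sub_lintegral_neg_part hint]
    exact sub_le_self _ ENNReal.toReal_nonneg
  refine h1.trans (lintegral_mono fun τ => ?_)
  refine (Finset.le_sum_of_subadditive ENNReal.ofReal ENNReal.ofReal_zero.le
    (fun _ _ => ENNReal.ofReal_add_le) _ _).trans (Finset.sum_le_sum fun h _ => ?_)
  rw [← Nat.cast_sub h.2.le, ENNReal.ofReal_mul (Nat.cast_nonneg _), ENNReal.ofReal_natCast]

/-- The chi-square constant for the data set, for the tilt by the positive part of `t f`. -/
theorem one_add_mul_lintegral_tilt_sq_pow_le (M : MDP S A) (πb : Kernel S A) [IsMarkovKernel πb]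
    (ξb : Measure S) [IsProbabilityMeasure ξb] {H K : ℕ} (hH : 0 < H) (hK : 0 < K)
    {f : S × A → ℝ} (hf : Measurable f) {b : ℝ} (hb : ∀ x, |f x| ≤ b)
    (h1 : M.dataMean πb ξb H (fun x => f x ^ 2) ≤ 1) {c t θ : ℝ} (hc : 0 < c)
    (ht : t ^ 2 = c / (32 * (K * H))) (hθ0 : 0 ≤ θ) (hθ : θ ^ H ≤ 2) :
    (1 + ENNReal.ofReal θ ^ H * ∫⁻ τ, ∑ h : Fin H,
      (c⁻¹.toNNReal : ℝ≥0∞) * ENNReal.ofReal (t * f (τ h.castSucc).1) ^ 2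
        ∂(M.episode πb ξb H)) ^ K ≤ ENNReal.ofReal (13 / 10) := by
  have hH' : (0 : ℝ) < H := by exact_mod_cast hH
  have hK' : (0 : ℝ) < K := by exact_mod_cast hK
  -- Taking the positive part can only lower the second moment.
  have hsq : ∀ a : ℝ, ENNReal.ofReal a ^ 2 ≤ ENNReal.ofReal (a ^ 2) := by
    intro a
    rcases le_total 0 a with ha | ha
    · rw [ENNReal.ofReal_pow ha]
    · rw [ENNReal.ofReal_of_nonpos ha]; simp
  have hint : Integrable (fun τ : Fin (H + 1) → (S × A) × ℝ =>
      (1 / (H : ℝ)) * ∑ h : Fin H, f (τ h.castSucc).1 ^ 2) (M.episode πb ξb H) :=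
    (integrable_finsetSum _ fun h _ => M.integrable_episode_comp πb ξb H h.castSucc
      (f := fun x => f x ^ 2) (hf.pow_const 2) (B := b ^ 2) fun x => by
        rw [abs_of_nonneg (sq_nonneg _)]
        exact sq_le_sq' (abs_le.1 (hb x)).1 (abs_le.1 (hb x)).2).const_mul _
  have hI : ∫⁻ τ, ∑ h : Fin H, (c⁻¹.toNNReal : ℝ≥0∞) *
      ENNReal.ofReal (t * f (τ h.castSucc).1) ^ 2 ∂(M.episode πb ξb H) ≤
        ENNReal.ofReal (1 / (32 * K)) := by
    calc _ ≤ ∫⁻ τ, ENNReal.ofReal (1 / (32 * K)) * ENNReal.ofReal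
          ((1 / (H : ℝ)) * ∑ h : Fin H, f (τ h.castSucc).1 ^ 2) ∂(M.episode πb ξb H) := by
          refine lintegral_mono fun τ => ?_
          rw [← ENNReal.ofReal_mul (by positivity), ← mul_assoc, Finset.mul_sum,
            ENNReal.ofReal_sum_of_nonneg fun h _ => by positivity]
          refine Finset.sum_le_sum fun h _ => ?_
          refine (mul_le_mul_right (hsq _) _).trans ?_
          change ENNReal.ofReal c⁻¹ * _ ≤ _
          rw [← ENNReal.ofReal_mul (by positivity), mul_pow, ht]
          refine ENNReal.ofReal_le_ofReal (le_of_eq ?_)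
          field_simp
      _ = ENNReal.ofReal (1 / (32 * K)) *
          ENNReal.ofReal (M.dataMean πb ξb H fun x => f x ^ 2) := by
          rw [lintegral_const_mul' _ _ ENNReal.ofReal_ne_top, dataMean,
            ofReal_integral_eq_lintegral_ofReal hint
              (Filter.Eventually.of_forall fun τ => by simp only [Pi.zero_apply]; positivity)]
      _ ≤ ENNReal.ofReal (1 / (32 * K)) * ENNReal.ofReal 1 := by gcongr
      _ = _ := by rw [ENNReal.ofReal_one, mul_one]
  have hbase : 1 + ENNReal.ofReal θ ^ H * ∫⁻ τ, ∑ h : Fin H, (c⁻¹.toNNReal : ℝ≥0∞) *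
      ENNReal.ofReal (t * f (τ h.castSucc).1) ^ 2 ∂(M.episode πb ξb H) ≤
        ENNReal.ofReal (1 + 1 / (16 * K)) := by
    calc _ ≤ 1 + ENNReal.ofReal 2 * ENNReal.ofReal (1 / (32 * K)) := by
          gcongr
          rw [← ENNReal.ofReal_pow hθ0]
          exact ENNReal.ofReal_le_ofReal hθ
      _ = _ := by
          rw [← ENNReal.ofReal_mul (by norm_num), ENNReal.ofReal_add zero_le_one (by positivity),
            ENNReal.ofReal_one]
          congr 2
          field_simp
          norm_num
  calc _ ≤ ENNReal.ofReal (1 + 1 / (16 * K)) ^ K := by gcongr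
    _ = ENNReal.ofReal ((1 + 1 / (16 * K)) ^ K) := (ENNReal.ofReal_pow (by positivity) _).symm
    _ ≤ _ := by
      refine ENNReal.ofReal_le_ofReal ?_
      -- The final numerical bound comes from `exp (-1/16) ≥ 15/16`, so that `exp (1/16) ≤ 16/15`.
      calc (1 + 1 / (16 * (K : ℝ))) ^ K ≤ Real.exp (1 / (16 * K)) ^ K := by
            gcongr
            linarith [Real.add_one_le_exp (1 / (16 * (K : ℝ)))]
        _ = Real.exp (1 / 16) := by
            rw [← Real.exp_nat_mul]
            congr 1
            field_simp
        _ ≤ 13 / 10 := by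
            have h2 := Real.add_one_le_exp (-(1 / 16) : ℝ)
            have h3 : Real.exp (1 / 16) * Real.exp (-(1 / 16)) = 1 := by
              rw [← Real.exp_add]; simp
            nlinarith [Real.exp_pos (1 / 16 : ℝ)]

theorem self_mem_neighborhood (M : MDP S A) {ε : ℝ} (hε : 0 ≤ ε) : M ∈ M.neighborhood ε :=
  ⟨rfl, fun x => by simpa [tvDist] using hε⟩

/-- If the mismatch is positive, then it is nearly attained by a normalized function. -/
theorem exists_dataMean_sq_eq_one_of_lt_mismatch {M : MDP S A} {π πb : Kernel S A}
    {ξ₀ ξb : Measure S} {H : ℕ} {𝒬 : Submodule ℝ (S × A → ℝ)} {b : ℝ}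
    (h𝒬 : ∀ f ∈ 𝒬, ∀ x, |f x| ≤ b * √(M.dataMean πb ξb H fun x => f x ^ 2))
    {r : ℝ} (hr0 : 0 ≤ r) (hr : ENNReal.ofReal r < M.mismatch π πb ξ₀ ξb H 𝒬) :
    ∃ f ∈ 𝒬, M.dataMean πb ξb H (fun x => f x ^ 2) = 1 ∧ r < M.weightedMean π ξ₀ H f := by
  obtain ⟨f, hf⟩ := lt_iSup_iff.1 hr
  obtain ⟨hfQ, hf⟩ := lt_iSup_iff.1 hf
  set q := √(M.dataMean πb ξb H fun x => f x ^ 2) with hq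
  rcases (Real.sqrt_nonneg (M.dataMean πb ξb H fun x => f x ^ 2)).eq_or_lt with h0 | h0
  · have hz : ∀ x, f x = 0 := fun x => by
      have := h𝒬 f hfQ x
      rw [← h0, mul_zero] at this
      exact abs_nonpos_iff.1 this
    simp [weightedMean, hz] at hf
  · rw [← hq] at h0
    refine ⟨fun x => q⁻¹ * f x, 𝒬.smul_mem q⁻¹ hfQ, ?_, ?_⟩
    · simp only [mul_pow]
      rw [dataMean_smul, ← Real.sq_sqrt (M.dataMean_sq_nonneg πb ξb H f), ← hq, ← mul_pow,
        inv_mul_cancel₀ h0.ne', one_pow]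
    · rw [weightedMean_smul]
      rw [← ENNReal.ofReal_div_of_pos h0] at hf
      have := (ENNReal.ofReal_lt_ofReal_iff_of_nonneg hr0).1 hf
      rwa [div_eq_inv_mul] at this

end MDP

/-! ### The minimax lower bound. -/

theorem theorem3 {S A : Type*} [MeasurableSpace S] [MeasurableSpace A]
    [MeasurableSpace.CountablyGenerated S]
    -- the instance, the horizon, the target and behavior policies, the initial distributions
    (M : MDP S A) (H : ℕ) (hH : 0 < H)
    (π πb : Kernel S A) [IsMarkovKernel π] [IsMarkovKernel πb]
    (ξ₀ ξb : Measure S) [IsProbabilityMeasure ξ₀] [IsProbabilityMeasure ξb]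
    -- the features
    (d : ℕ) (φ : S × A → Fin d → ℝ) (hφ : Measurable φ)
    (hcov : (M.dataCov πb ξb H φ).PosDef)
    (C₁ : ℝ) (hC₁ : ∀ x, dotProduct (φ x) (((M.dataCov πb ξb H φ)⁻¹).mulVec (φ x)) ≤ C₁ * d)
    -- the high-value and the low-value states
    (Shi Slo : Set S) (hShi : MeasurableSet Shi) (hSlo : MeasurableSet Slo)
    (hVhi : ∀ h ≤ H, ∀ s ∈ Shi, 3 / 4 * ((H : ℝ) - h + 1) ≤ M.stateValue π H h s)
    (hVlo : ∀ h ≤ H, ∀ s ∈ Slo, M.stateValue π H h s ≤ 1 / 4 * ((H : ℝ) - h + 1))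
    (c : ℝ) (hc : 0 < c)
    (hphi : ENNReal.ofReal c ≤ M.minTrans πb Shi)
    (hplo : ENNReal.ofReal c ≤ M.minTrans πb Slo) :
    ∃ N₀ : ℕ, ∀ K N : ℕ, N = K * H → N₀ ≤ N →
      ∀ ε : ℝ, Real.sqrt (C₁ / 32) * Real.sqrt (c * d / N) ≤ ε →
        (1 / 6 : ℝ≥0∞) ≤
          ⨅ vhat : {v : (Fin K → Fin (H + 1) → (S × A) × ℝ) → ℝ // Measurable v},
            ⨆ M' ∈ M.neighborhood ε,
              M'.dataLaw πb ξb H K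
                {D | ENNReal.ofReal (Real.sqrt c / (24 * Real.sqrt N)) *
                    M'.mismatch π πb ξ₀ ξb H (featureSpan φ) ≤
                  ENNReal.ofReal |M'.value π ξ₀ H - vhat.1 D|} := by
  set b := √(C₁ * d) with hb
  have hb0 : 0 ≤ b := Real.sqrt_nonneg _
  have h𝒬 : ∀ f ∈ featureSpan φ, Measurable f ∧
      ∀ x, |f x| ≤ b * √(M.dataMean πb ξb H fun x => f x ^ 2) := by
    intro f hf
    obtain ⟨h1, h2⟩ := M.measurable_and_sq_le_of_mem_featureSpan πb ξb H hφ hcov hC₁ hf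
    refine ⟨h1, fun x => ?_⟩
    rw [hb, ← Real.sqrt_mul' _ (M.dataMean_sq_nonneg πb ξb H f)]
    exact Real.abs_le_sqrt (h2 x)
  -- With zero mismatch the threshold is 0, and `M` itself makes the error event certain.
  by_cases hzero : M.mismatch π πb ξ₀ ξb H (featureSpan φ) = 0
  · refine ⟨0, fun K N _ _ ε hε => le_iInf fun vhat => ?_⟩
    refine le_iSup₂_of_le M (M.self_mem_neighborhood (le_trans (by positivity) hε)) ?_
    simp only [hzero, mul_zero, zero_le, Set.ofPred_true, measure_univ]
    exact ENNReal.div_le_of_le_mul (by norm_num)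
  have hfin : M.mismatch π πb ξ₀ ξb H (featureSpan φ) ≤ ENNReal.ofReal (H ^ 2 * b) := by
    have hle : ∀ μ : Measure (Fin (H + 1) → (S × A) × ℝ), ENNReal.ofReal 1 • μ ≤ μ := by simp
    refine MDP.mismatch_le (M := M) one_pos (hle _) (hle _) h𝒬 (R := H ^ 2 * b) (fun f hf => ?_)
      (by simp) (by positivity)
    -- Domination with `ρ = 0` is vacuous and leaves the trivial bound by the supremum of `|f|`.
    have := MDP.weightedMean_le (M := M) (M' := M) (π := π) (ξ := ξ₀) (H := H) le_rfl
      (by simpa using Measure.zero_le _) (h𝒬 f hf).1 (h𝒬 f hf).2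
    linarith
  set R := (M.mismatch π πb ξ₀ ξb H (featureSpan φ)).toReal with hRdef
  have hRtop := ne_top_of_le_ne_top ENNReal.ofReal_ne_top hfin
  have hR : 0 < R := ENNReal.toReal_pos hzero hRtop
  have hRof : ENNReal.ofReal R = M.mismatch π πb ξ₀ ξb H (featureSpan φ) :=
    ENNReal.ofReal_toReal hRtop
  have hRf : ∀ f ∈ featureSpan φ, M.weightedMean π ξ₀ H f ≤
      R * √(M.dataMean πb ξb H fun x => f x ^ 2) := fun f hf =>
    MDP.weightedMean_le_of_mismatch_le (fun f hf => (h𝒬 f hf).2) hRof.ge hR.le hf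
  obtain ⟨f, hfQ, hf1, hfW⟩ := MDP.exists_dataMean_sq_eq_one_of_lt_mismatch
    (fun f hf => (h𝒬 f hf).2) (r := 999 / 1000 * R) (by positivity)
    (by rw [← hRof]; exact (ENNReal.ofReal_lt_ofReal_iff hR).2 (by linarith))
  obtain ⟨hfm, hfb⟩ := h𝒬 f hfQ
  rw [hf1, Real.sqrt_one, mul_one] at hfb
  obtain ⟨η₀, hη₀, hsmall⟩ := exists_pos_forall_le_perturbation (c := c) hR (H ^ 2 * b) H
  -- The ceiling is the condition `t b ≤ η₀` solved for `N`; the added 1 makes `N`, and hence `K`,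
  -- positive.
  refine ⟨⌈c * b ^ 2 / (32 * η₀ ^ 2)⌉₊ + 1, fun K N hN hN₀ ε hε => le_iInf fun vhat => ?_⟩
  have hNpos : 0 < N := by omega
  have hN' : (0 : ℝ) < N := by exact_mod_cast hNpos
  have hK : 0 < K := Nat.pos_of_ne_zero fun h => by simp [h] at hN; omega
  set t := √(c / (32 * N)) with ht
  have ht2 : t ^ 2 = c / (32 * N) := Real.sq_sqrt (by positivity)
  have ht0 : 0 ≤ t := Real.sqrt_nonneg _
  set η := t * b with hη
  have hη0 : 0 ≤ η := by positivity
  have hηle : η ≤ η₀ := by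
    refine abs_le_of_sq_le_sq' (a := η) (b := η₀) ?_ hη₀.le |>.2
    rw [hη, mul_pow, ht2]
    have h1 : c * b ^ 2 / (32 * η₀ ^ 2) ≤ N :=
      (Nat.le_ceil _).trans (by exact_mod_cast (Nat.le_succ _).trans hN₀)
    rw [div_le_iff₀ (by positivity)] at h1
    rw [div_mul_eq_mul_div, div_le_iff₀ (by positivity)]
    linarith
  obtain ⟨hη1, hmis, hgap, hβ, hθ⟩ := hsmall η hη0 hηle
  -- For `C₁ ≥ 0`, `η` is exactly the lower limit imposed on `ε`. For `C₁ < 0` the square root makes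
  -- `b`, and so `η`, equal to 0.
  have hηε : η ≤ ε := by
    refine le_trans ?_ hε
    rcases le_or_gt 0 C₁ with h | h
    · rw [hη, ht, hb, ← Real.sqrt_mul (by positivity), ← Real.sqrt_mul (by positivity)]
      refine Real.sqrt_le_sqrt (le_of_eq ?_)
      field_simp
    · rw [hη, hb, Real.sqrt_eq_zero_of_nonpos (mul_nonpos_of_nonpos_of_nonneg h.le (by positivity)),
        mul_zero]
      positivity
  set δ : S × A → ℝ≥0∞ := fun x => ENNReal.ofReal (t * f x) with hδdef
  have hδ : Measurable δ := by fun_prop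
  have hδη : ∀ x, δ x ≤ ENNReal.ofReal η := fun x =>
    ENNReal.ofReal_le_ofReal (mul_le_mul_of_nonneg_left ((le_abs_self _).trans (hfb x)) ht0)
  have hδ1 : ∀ x, δ x ≤ 1 := fun x => (hδη x).trans (ENNReal.ofReal_le_one.2 hη1.le)
  -- the conditional laws
  obtain ⟨s₀⟩ : Nonempty S := nonempty_of_isProbabilityMeasure ξ₀
  obtain ⟨a₀, ha₀⟩ := (M.ae_minTrans_le πb s₀).exists
  have hmfin : IsFiniteMeasure (M.minTrans πb) := isFiniteMeasure_of_le _ ha₀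
  have hne : ∀ B, ENNReal.ofReal c ≤ M.minTrans πb B → M.minTrans πb B ≠ 0 := fun B h =>
    ((ENNReal.ofReal_pos.2 hc).trans_le h).ne'
  have hν : ∀ B, ENNReal.ofReal c ≤ M.minTrans πb B → ∀ s, ∀ᵐ a ∂(πb s),
      (M.minTrans πb)[|B] ≤ c⁻¹.toNNReal • M.trans (s, a) := fun B h s =>
    (M.ae_minTrans_le πb s).mono fun a ha => cond_le_smul ha hc h
  set ν₁ := (M.minTrans πb)[|Shi]
  set ν₂ := (M.minTrans πb)[|Slo]
  have : IsProbabilityMeasure ν₁ := cond_isProbabilityMeasure (hne _ hphi)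
  have : IsProbabilityMeasure ν₂ := cond_isProbabilityMeasure (hne _ hplo)
  -- the values of the two instances
  have hW0 : 0 ≤ M.weightedMean π ξ₀ H f := le_trans (by positivity) hfW.le
  have hvalue := M.value_tilt_add_le π hδ hδ1 ν₁ ν₂ hη0 hη1.le hδη H
    ((ae_cond_mem hShi).mono fun s hs h hh => hVhi h hh s hs)
    ((ae_cond_mem hSlo).mono fun s hs h hh => hVlo h hh s hs) hβ ξ₀
    (W := t * M.weightedMean π ξ₀ H f) (by positivity) (by
      rw [← MDP.weightedMean_smul]
      refine M.ofReal_weightedMean_le π ξ₀ H (hfm.const_mul t) (b := η) fun x => ?_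
      rw [abs_mul, abs_of_nonneg ht0]
      exact mul_le_mul_of_nonneg_left (hfb x) ht0)
  -- the mismatch of the two instances
  have hmismatch : ∀ (ν : Measure S) [IsProbabilityMeasure ν],
      (M.tilt ν δ hδ hδ1).mismatch π πb ξ₀ ξb H (featureSpan φ) ≤
        ENNReal.ofReal (101 / 100 * R) := fun ν _ =>
    MDP.mismatch_le (pow_pos (by linarith) H)
      (M.ofReal_smul_episode_le_tilt π hδ hδ1 ν hη0 hη1.le hδη ξ₀ H)
      (M.ofReal_smul_episode_le_tilt πb hδ hδ1 ν hη0 hη1.le hδη ξb H) h𝒬 hRf hmis (by positivity)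
  -- the statistical distance
  have hchi := M.one_add_mul_lintegral_tilt_sq_pow_le πb ξb hH hK hfm hfb hf1.le hc (t := t)
    (θ := (1 + η / c) ^ 2) (by rw [ht2, hN]; push_cast; rfl) (by positivity) hθ
  have hθδ : ∀ x, (1 + δ x * (c⁻¹.toNNReal : ℝ≥0∞)) ^ 2 ≤ ENNReal.ofReal ((1 + η / c) ^ 2) := by
    intro x
    rw [ENNReal.ofReal_pow (by positivity), ENNReal.ofReal_add zero_le_one (by positivity),
      ENNReal.ofReal_one, div_eq_mul_inv, ENNReal.ofReal_mul hη0]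
    have := hδη x
    gcongr
    rfl
  have hθ1 : 1 ≤ ENNReal.ofReal ((1 + η / c) ^ 2) := by
    rw [ENNReal.one_le_ofReal]
    exact one_le_pow₀ (by linarith [show 0 ≤ η / c by positivity])
  -- The largest error threshold that either rival can require.
  set T := √c / (24 * √N) * (101 / 100 * R) with hT
  have hT2 : 2 * T ≤ (M.tilt ν₁ δ hδ hδ1).value π ξ₀ H - (M.tilt ν₂ δ hδ hδ1).value π ξ₀ H := by
    set y := √c / √N with hy
    have hy0 : 0 ≤ y := by positivity
    have hTy : 2 * T = 101 / 1200 * R * y := by rw [hT, hy]; field_simp; norm_num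
    -- A rational lower bound for `√(1/32)`. The gap then suffices because `0.499 · 0.1767 · 0.999 >
    -- 101/1200`.
    have hty : 1767 / 10000 * y ≤ t := by
      refine Real.le_sqrt_of_sq_le ?_
      have hy2 : y ^ 2 = c / N := by rw [hy, div_pow, Real.sq_sqrt hc.le, Real.sq_sqrt hN'.le]
      rw [mul_pow, hy2, show c / (32 * (N : ℝ)) = 1 / 32 * (c / N) by field_simp]
      have : 0 ≤ c / N := by positivity
      nlinarith
    have h1 : 499 / 1000 * ((1767 / 10000 * y) * (999 / 1000 * R)) ≤
        ((3 / 2 * (1 - η) ^ H - 1) * (1 - η) ^ H) * (t * M.weightedMean π ξ₀ H f) := by gcongr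
    have h2 : 0 ≤ R * y := by positivity
    rw [hTy]
    nlinarith
  have hB : ∀ v : ℝ, MeasurableSet {D | T ≤ |v - vhat.1 D|} := fun v =>
    measurableSet_le measurable_const ((measurable_const.sub vhat.2).abs)
  have hevent : ∀ (ν : Measure S) [IsProbabilityMeasure ν],
      {D | T ≤ |(M.tilt ν δ hδ hδ1).value π ξ₀ H - vhat.1 D|} ⊆
        {D | ENNReal.ofReal (√c / (24 * √N)) *
            (M.tilt ν δ hδ hδ1).mismatch π πb ξ₀ ξb H (featureSpan φ) ≤
          ENNReal.ofReal |(M.tilt ν δ hδ hδ1).value π ξ₀ H - vhat.1 D|} := by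
    intro ν _ D hD
    refine le_trans ?_ (ENNReal.ofReal_le_ofReal hD)
    rw [hT, ENNReal.ofReal_mul (by positivity)]
    gcongr
    exact hmismatch ν
  rcases le_measure_or_le_measure_of_sq_le (P := M.dataLaw πb ξb H K) hchi
    (fun B hB => M.dataLaw_tilt_sq_le ν₁ hδ hδ1 πb (hν _ hphi) hθδ hθ1 ξb H K hB)
    (fun B hB => M.dataLaw_tilt_sq_le ν₂ hδ hδ1 πb (hν _ hplo) hθδ hθ1 ξb H K hB)
    (hB ((M.tilt ν₁ δ hδ hδ1).value π ξ₀ H))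
    -- An estimate within `T` of the first value is at least `T` away from the second, since the
    -- values are `2 T` apart.
    (B₂ := {D | T ≤ |(M.tilt ν₂ δ hδ hδ1).value π ξ₀ H - vhat.1 D|}) (by
      intro D hD
      simp only [Set.mem_compl_iff, Set.mem_ofPred_eq, not_le] at hD ⊢
      have h1 := (abs_lt.1 hD).2
      refine le_trans ?_ (neg_le_abs _)
      linarith) with h | h
  · exact le_iSup₂_of_le (M.tilt ν₁ δ hδ hδ1)
      (M.tilt_mem_neighborhood ν₁ hδ hδ1 hη0 hδη hηε) (h.trans (measure_mono (hevent ν₁)))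
  · exact le_iSup₂_of_le (M.tilt ν₂ δ hδ hδ1)
      (M.tilt_mem_neighborhood ν₂ hδ hδ1 hη0 hδη hηε) (h.trans (measure_mono (hevent ν₂)))
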